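/- Let $\mathbb U=\{z\in\mathbb C:|z|<1\}$, $p\in\mathbb N=\{1,2,\dots\}$, $m\in\mathbb Z$, and let $\alpha,\beta,\mu,\gamma,A,B$ be real with $\beta>0$, $\alpha+p\beta>0$, $0<\mu<1$, $0<\gamma\le 1$, $-1\le B<A\le 1$ and $A\le 1-\mu(1-B)$. Let $\mathcal A_p$ be the class of functions $f(z)=z^p+\sum_{k=p+1}^\infty a_kz^k$ analytic in $\mathbb U$, and for $f\in\mathcal A_p$ and $j\in\mathbb Z$ put $$\Theta^jf(z)=z^p+\sum_{k=p+1}^\infty\left(\frac{\alpha+k\beta}{\alpha+p\beta}\right)^{j}a_kz^k .$$ For $f,g$ analytic in $\mathbb U$, write $f\prec g$ if $f=g\circ w$ in $\mathbb U$ for some analytic $w:\mathbb U\to\mathbb U$ with $w(0)=0$. Powers have their principal values, and the functions $(\Theta^mf/z^p)^{1/\gamma}$ and $\Theta^{m+1}f/\Theta^mf$ are given their limit $1$ at $z=0$. Let $\mathcal F$ be the set of all $f\in\mathcal A_p$ such that $$(1-\mu)\left(\frac{\Theta^{m}f(z)}{z^p}\right)^{1/\gamma}+\mu\,\frac{\Theta^{m+1}f(z)}{\Theta^{m}f(z)}\prec\frac{1+Az}{1+Bz}\qquad(z\in\mathbb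 U)$$ (in particular, the left-hand side is analytic in $\mathbb U$). Define $$q(z)=\frac{\mu\beta\gamma}{(1-\mu)(\alpha+p\beta)}\,\frac1{Q(z)},\qquad Q(z)=\begin{cases}\displaystyle\int_0^1t^{\frac{(1-\mu)(\alpha+p\beta)}{\mu\beta\gamma}-1}\left(\frac{1+Btz}{1+Bz}\right)^{\frac{\alpha+p\beta}{\mu\beta\gamma}\cdot\frac{A-B}{B}}dt,&B\ne0,\\[2ex]\displaystyle\int_0^1t^{\frac{(1-\mu)(\alpha+p\beta)}{\mu\beta\gamma}-1}\exp\left(\frac{\alpha+p\beta}{\mu\beta\gamma}A(t-1)z\right)dt,&B=0.\end{cases}$$ Then: 1. For every $f\in\mathcal F$, $$\left(\frac{\Theta^{m}f(z)}{z^p}\right)^{1/\gamma}\prec q(z)\prec\frac{1+\frac{A-\mu B}{1-\mu}z}{1+Bz}\qquad(z\in\mathbb U),$$ (the second subordination does not depend on $f$), and $q$ is the best dominant: $q$ is univalent in $\mathbb U$, and $q\prec g$ for every univalent analytic $g$ on $\mathbb U$ such that $(\Theta^mf/z^p)^{1/\gamma}\prec g$ for all $f\in\mathcal F$. 2. If moreover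 $-1\le B<0$ and $A\le\min\left\{1-\mu(1-B),\,-\mu\left(\frac{\beta\gamma}{\alpha+p\beta}-1\right)B\right\}$, then for every $f\in\mathcal F$ $$\operatorname{Re}\left(\frac{\Theta^{m}f(z)}{z^p}\right)^{1/\gamma}>\xi\qquad(z\in\mathbb U),$$ where $$\xi=\left\{{}_2F_1\left(1,\frac{\alpha+p\beta}{\mu\beta\gamma}\cdot\frac{B-A}{B};\frac{(1-\mu)(\alpha+p\beta)}{\mu\beta\gamma}+1;\frac{B}{B-1}\right)\right\}^{-1},$$ and the result is best possible: no number larger than $\xi$ has this property for all $f\in\mathcal F$. -/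

import Mathlib

namespace DiskSubordination

noncomputable section

/-- The open unit disk of the complex plane. -/
def disk : Set ℂ := Metric.ball 0 1

/-- `f ≺ g`: both functions are analytic in the open unit disk and `f = g ∘ w` there for some
analytic `w` from the disk to itself with `w 0 = 0`. -/
def Subordinate (f g : ℂ → ℂ) : Prop :=
  DifferentiableOn ℂ f disk ∧ DifferentiableOn ℂ g disk ∧
    ∃ w : ℂ → ℂ, DifferentiableOn ℂ w disk ∧ w 0 = 0 ∧ Set.MapsTo w disk disk ∧
      ∀ z ∈ disk, f z = g (w z)

/-- A dominant of a family `S` of functions: a univalent function of the open unit disk to which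
every member of `S` is subordinate. -/
def IsDominant (S : Set (ℂ → ℂ)) (q : ℂ → ℂ) : Prop :=
  DifferentiableOn ℂ q disk ∧ Set.InjOn q disk ∧ ∀ φ ∈ S, Subordinate φ q

/-- The best dominant: a dominant that is subordinate to every dominant. -/
def IsBestDominant (S : Set (ℂ → ℂ)) (q : ℂ → ℂ) : Prop :=
  IsDominant S q ∧ ∀ g : ℂ → ℂ, IsDominant S g → Subordinate q g

/-- The coefficient of `z ^ k` in the Taylor expansion of `f` at the origin. -/
def taylorCoeff (f : ℂ → ℂ) (k : ℕ) : ℂ := iteratedDeriv k f 0 / (k.factorial : ℂ)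

/-- The class of functions `f z = z ^ p + ∑_{k ≥ p + 1} a_k z ^ k` analytic in the open unit
disk. -/
def ClassA (p : ℕ) : Set (ℂ → ℂ) :=
  {f | DifferentiableOn ℂ f disk ∧ (∀ k < p, taylorCoeff f k = 0) ∧ taylorCoeff f p = 1}

/-- The linear operator
`Θ_p^m(α, β) f z = z ^ p + ∑_{k ≥ p + 1} ((α + k β) / (α + p β)) ^ m a_k z ^ k`, for an integer `m`
of either sign. -/
def Theta (p : ℕ) (α β : ℝ) (m : ℤ) (f : ℂ → ℂ) (z : ℂ) : ℂ :=
  z ^ p + ∑' j : ℕ, (((α + ((p + 1 + j : ℕ) : ℝ) * β) / (α + (p : ℝ) * β)) ^ m : ℝ) *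
    taylorCoeff f (p + 1 + j) * z ^ (p + 1 + j)

/-- The function `(Θ^m f(z) / z ^ p) ^ (1 / γ)` with the principal value of the power; the
removable singularity at the origin is filled in with the limit `1`. -/
def powerQuotient (p : ℕ) (α β γ : ℝ) (m : ℤ) (f : ℂ → ℂ) (z : ℂ) : ℂ :=
  if z = 0 then 1 else (Theta p α β m f z / z ^ p) ^ ((1 / γ : ℝ) : ℂ)

/-- The function `Θ^(m+1) f(z) / Θ^m f(z)`; the removable singularity at the origin is filled in
with the limit `1`. -/
def thetaRatio (p : ℕ) (α β : ℝ) (m : ℤ) (f : ℂ → ℂ) (z : ℂ) : ℂ :=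
  if z = 0 then 1 else Theta p α β (m + 1) f z / Theta p α β m f z

/-- The function `(1 + A z) / (1 + B z)`. -/
def janowski (A B : ℝ) (z : ℂ) : ℂ := (1 + (A : ℂ) * z) / (1 + (B : ℂ) * z)

/-- The functions `f` of `ClassA p` with
`(1 - μ) (Θ^m f / z ^ p) ^ (1 / γ) + μ Θ^(m+1) f / Θ^m f ≺ (1 + A z) / (1 + B z)`. -/
def Admissible (p : ℕ) (m : ℤ) (α β μ γ A B : ℝ) : Set (ℂ → ℂ) :=
  {f | f ∈ ClassA p ∧
    Subordinate
      (fun z => (1 - (μ : ℂ)) * powerQuotient p α β γ m f z + (μ : ℂ) * thetaRatio p α β m f z)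
      (janowski A B)}

/-- The integral `Q(z)`, with principal values of the powers. -/
def Q (p : ℕ) (α β μ γ A B : ℝ) (z : ℂ) : ℂ :=
  if B = 0 then
    ∫ t in (0 : ℝ)..1,
      ((t ^ ((1 - μ) * (α + p * β) / (μ * β * γ) - 1) : ℝ) : ℂ) *
        Complex.exp (((α + p * β) / (μ * β * γ) * A * (t - 1) : ℝ) * z)
  else
    ∫ t in (0 : ℝ)..1,
      ((t ^ ((1 - μ) * (α + p * β) / (μ * β * γ) - 1) : ℝ) : ℂ) *
        ((1 + (B : ℂ) * t * z) / (1 + (B : ℂ) * z)) ^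
          (((α + p * β) / (μ * β * γ) * ((A - B) / B) : ℝ) : ℂ)

/-- The function `q(z) = μ β γ / ((1 - μ) (α + p β)) * (1 / Q(z))`. -/
def q (p : ℕ) (α β μ γ A B : ℝ) (z : ℂ) : ℂ :=
  ((μ * β * γ / ((1 - μ) * (α + p * β)) : ℝ) : ℂ) * (1 / Q p α β μ γ A B z)

/-- The reciprocal of the Gauss hypergeometric function
`₂F₁(1, (α + p β) / (μ β γ) * (B - A) / B; (1 - μ) (α + p β) / (μ β γ) + 1; B / (B - 1))`. -/
def xi (p : ℕ) (α β μ γ A B : ℝ) : ℝ :=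
  (ordinaryHypergeometric (1 : ℝ) ((α + p * β) / (μ * β * γ) * ((B - A) / B))
    ((1 - μ) * (α + p * β) / (μ * β * γ) + 1) (B / (B - 1)))⁻¹

end

end DiskSubordination

open Set Filter Topology ComplexConjugate MeasureTheory

namespace DiskSubordination

/-! Put F = Θ^m f / z^p, φ = F^(1/γ), δ = β/(α+pβ). Raising the exponent of Θ by one applies 1 + δ z
d/dz to F (`thetaQuot_succ`), so the condition defining the class becomes φ + z φ'/(κφ) = h ∘ w,
with w a Schwarz function, κ = (1-μ)(α+pβ)/(μβγ), h = `janowski a B` and a = (A-μB)/(1-μ)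
(`Admissible.briotBouquet`). The bound A ≤ 1-μ(1-B) says a ≤ 1, which makes Re h positive.

For w = id the equation is linear in the reciprocal V = 1/q, namely z V' + κ h V = κ, and V = κQ
solves it (`isBriotBouquetRecip_Q`). The properties of q come from this equation and a lemma of Jack
type, `exists_nonneg_mul_deriv_eq`: where |g| is maximal on a closed disk, z g'/g is real and
nonnegative. It gives Re V > 0, q ≺ h, and positivity of the real part of the derivative of -log V ∘
h⁻¹ on disks; the last makes q univalent by the Noshiro–Warschawski criterion.

For dominance, lift φ through q to ω = q⁻¹ ∘ φ. If |ω| exceeded |z|, Jack's argument at a maximum of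
|ω/z| would make h(ω) a convex combination of h(w) and q(ω), placing it strictly inside a disk on
whose boundary circle it lies (`norm_lift_le`). A continuation argument shows that the lift exists
on the whole disk (`subordinate_inv`). Conversely F = q^γ comes from a member of the class, so every
dominant of the class dominates q.

For the second part, V(z) = ₂F₁(1, b; κ+1; u) with u = Bz/(1+Bz). The extra bound on A is b ≤ κ+1,
under which the coefficients are moments of a probability measure ν on [0,1], so V = ∫ (1-tu)⁻¹
dν(t) (`eq_integral`). As Re u ≤ x₀ = B/(B-1), each integrand value lies in the disk with diameter
[0, (1-t x₀)⁻¹]. Averaging puts V in the disk with diameter [0, ₂F₁(x₀)], that is, Re(1/V) ≥ ξ; the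
bound is approached as z → -1. -/

theorem mem_disk {z : ℂ} : z ∈ disk ↔ ‖z‖ < 1 := by simp [disk]

theorem isOpen_disk : IsOpen disk := Metric.isOpen_ball

theorem zero_mem_disk : (0 : ℂ) ∈ disk := by simp [disk]

/-! ### Jack's lemma and linear equations z V' + P V = R in the disk. -/

/-- At a point where the modulus of an analytic function is maximal in a closed disk through that
point, the logarithmic derivative `z f' / f` is a nonnegative real number. -/
theorem exists_nonneg_mul_deriv_eq {f : ℂ → ℂ} {f' z₀ : ℂ} (hf : HasDerivAt f f' z₀)
    (h0 : f z₀ ≠ 0) (hmax : ∀ z, ‖z‖ ≤ ‖z₀‖ → ‖f z‖ ≤ ‖f z₀‖) :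
    ∃ s : ℝ, 0 ≤ s ∧ z₀ * f' = s * f z₀ := by
  have key : ∀ v : ℂ, ∀ γ : ℝ → ℂ, HasDerivAt γ v 0 → γ 0 = z₀ →
      HasDerivAt (fun t => ‖f (γ t)‖ ^ 2) (2 * (conj (f z₀) * (f' * v)).re) 0 := by
    intro v γ hγ hγ0
    have h1 : HasDerivAt (fun t => f (γ t)) (f' * v) 0 := by
      subst hγ0
      exact hf.comp (0 : ℝ) hγ
    have h2 := h1.norm_sq
    simp only [Complex.inner, hγ0] at h2
    convert h2 using 2
    simp [mul_comm]
  -- Along the circle through z₀ the function |f|² has a local maximum at z₀, so its angular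
  -- derivative vanishes.
  have htan : (conj (f z₀) * (f' * (z₀ * Complex.I))).re = 0 := by
    have hγ : HasDerivAt (fun t : ℝ => z₀ * Complex.exp (t * Complex.I)) (z₀ * Complex.I) 0 := by
      have h1 : HasDerivAt (fun t : ℝ => (t : ℂ) * Complex.I) (1 * Complex.I) 0 :=
        (Complex.ofRealCLM.hasDerivAt (x := (0 : ℝ))).mul_const Complex.I
      simpa using (h1.cexp).const_mul z₀
    have h := key _ _ hγ (by simp)
    have hm : IsLocalMax (fun t : ℝ => ‖f (z₀ * Complex.exp (t * Complex.I))‖ ^ 2) 0 := by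
      refine Eventually.of_forall fun t => ?_
      have : ‖f (z₀ * Complex.exp (t * Complex.I))‖ ≤ ‖f z₀‖ :=
        hmax _ (by simp [Complex.norm_exp_ofReal_mul_I])
      simp only [Complex.ofReal_zero, zero_mul, Complex.exp_zero, mul_one]
      gcongr
    have := hm.hasDerivAt_eq_zero h
    linarith
  -- Along the radius |f|² cannot decrease at z₀; only times t < 0 stay inside the closed disk.
  have hrad : 0 ≤ (conj (f z₀) * (f' * z₀)).re := by
    have hγ : HasDerivAt (fun t : ℝ => z₀ * Complex.exp (t : ℂ)) z₀ 0 := by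
      have h1 : HasDerivAt (fun t : ℝ => (t : ℂ)) 1 0 :=
        Complex.ofRealCLM.hasDerivAt (x := (0 : ℝ))
      simpa using (h1.cexp).const_mul z₀
    have h := key _ _ hγ (by simp)
    by_contra! hneg
    have hlt : (2 * (conj (f z₀) * (f' * z₀)).re) < 0 := by linarith
    have hs := (hasDerivAt_iff_tendsto_slope.1 h).eventually (gt_mem_nhds hlt)
    have hs' : ∀ᶠ t in 𝓝[<] (0 : ℝ),
        slope (fun t : ℝ => ‖f (z₀ * Complex.exp (t : ℂ))‖ ^ 2) 0 t < 0 :=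
      hs.filter_mono (nhdsWithin_mono _ fun x hx => ne_of_lt hx)
    obtain ⟨t, ht, ht0⟩ := (hs'.and self_mem_nhdsWithin).exists
    have ht0 : t < 0 := ht0
    have hle : ‖f (z₀ * Complex.exp (t : ℂ))‖ ≤ ‖f z₀‖ := by
      refine hmax _ ?_
      rw [norm_mul, Complex.norm_exp, Complex.ofReal_re]
      exact mul_le_of_le_one_right (norm_nonneg _) (Real.exp_le_one_iff.2 ht0.le)
    have hle2 : ‖f (z₀ * Complex.exp (t : ℂ))‖ ^ 2 ≤ ‖f z₀‖ ^ 2 := by gcongr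
    rw [slope_def_field] at ht
    simp only [Complex.ofReal_zero, Complex.exp_zero, mul_one, sub_zero] at ht
    have := div_nonneg_of_nonpos (sub_nonpos.2 hle2) ht0.le
    linarith
  set w := conj (f z₀) * (f' * z₀) with hw
  have him : w.im = 0 := by
    have : conj (f z₀) * (f' * (z₀ * Complex.I)) = w * Complex.I := by rw [hw]; ring
    rw [this] at htan
    simpa using htan
  have hwr : w = (w.re : ℂ) := Complex.ext (by simp) (by simp [him])
  have hn : (0 : ℝ) < ‖f z₀‖ ^ 2 := by positivity
  refine ⟨w.re / ‖f z₀‖ ^ 2, by positivity, ?_⟩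
  have hc : conj (f z₀) ≠ 0 := by simpa using h0
  apply mul_left_cancel₀ hc
  have h3 : conj (f z₀) * f z₀ = ((‖f z₀‖ ^ 2 : ℝ) : ℂ) := by
    rw [Complex.conj_mul']; push_cast; rfl
  calc conj (f z₀) * (z₀ * f') = w := by rw [hw]; ring
    _ = (w.re : ℂ) := hwr
    _ = ((w.re / ‖f z₀‖ ^ 2 : ℝ) : ℂ) * ((‖f z₀‖ ^ 2 : ℝ) : ℂ) := by
      rw [← Complex.ofReal_mul, div_mul_cancel₀ _ hn.ne']
    _ = _ := by rw [← h3]; ring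

/-- A continuous real function on the open disk attains its maximum on closed disks. -/
theorem exists_max_closedBall {g : ℂ → ℝ} (hg : ContinuousOn g disk) {z : ℂ} (hz : z ∈ disk) :
    ∃ z₀ ∈ disk, ‖z₀‖ ≤ ‖z‖ ∧ ∀ x, ‖x‖ ≤ ‖z‖ → g x ≤ g z₀ := by
  have hsub : Metric.closedBall (0 : ℂ) ‖z‖ ⊆ disk := by
    intro x hx
    rw [mem_closedBall_zero_iff] at hx
    exact mem_disk.2 (hx.trans_lt (mem_disk.1 hz))
  obtain ⟨z₀, h1, h2⟩ := (isCompact_closedBall (0 : ℂ) ‖z‖).exists_isMaxOn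
    ⟨0, by simp⟩ (hg.mono hsub)
  exact ⟨z₀, hsub h1, by simpa using h1, fun x hx => h2 (by simpa using hx)⟩

theorem hasDerivAt_of_disk {f : ℂ → ℂ} (hf : DifferentiableOn ℂ f disk) {z : ℂ} (hz : z ∈ disk) :
    HasDerivAt f (deriv f z) z :=
  (hf.differentiableAt (isOpen_disk.mem_nhds hz)).hasDerivAt

/-- Solutions of `z V' + P V = 1` with `Re P > 0` have positive real part. -/
theorem re_pos_of_linear_ode {V P : ℂ → ℂ} (hV : DifferentiableOn ℂ V disk)
    (hP : ∀ z ∈ disk, 0 < (P z).re) (hode : ∀ z ∈ disk, z * deriv V z + P z * V z = 1)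
    {z : ℂ} (hz : z ∈ disk) : 0 < (V z).re := by
  obtain ⟨z₀, hz₀, hle, hmax⟩ := exists_max_closedBall (g := fun x => -(V x).re)
    (Complex.continuous_re.comp_continuousOn hV.continuousOn).neg hz
  -- A minimum of Re V is a maximum of the modulus of exp(-V), to which Jack's lemma applies.
  have hd := (hasDerivAt_of_disk hV hz₀).neg.cexp
  obtain ⟨s, hs, hs'⟩ := exists_nonneg_mul_deriv_eq hd (Complex.exp_ne_zero _) (by
    intro x hx
    simpa [Complex.norm_exp] using hmax x (hx.trans hle))
  have h1 : -(z₀ * deriv V z₀) = s := by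
    apply mul_right_cancel₀ (Complex.exp_ne_zero ((-V) z₀))
    rw [← hs']; ring
  have h2 : P z₀ * V z₀ = ((1 + s : ℝ) : ℂ) := by
    push_cast
    linear_combination hode z₀ hz₀ + h1
  have hP0 := hP z₀ hz₀
  have hPne : P z₀ ≠ 0 := fun h => by simp [h] at hP0
  have h3 : V z₀ = ((1 + s : ℝ) : ℂ) / P z₀ := by
    rw [← h2]; field_simp
  have h4 : 0 < (V z₀).re := by
    rw [h3, Complex.div_re]
    have := Complex.normSq_pos.2 hPne
    simp only [Complex.ofReal_re, Complex.ofReal_im, zero_mul, zero_div, add_zero]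
    positivity
  linarith [hmax z le_rfl]

/-- Uniqueness of analytic solutions of `z V' + P V = R` when `Re P > 0`. -/
theorem eqOn_of_linear_ode {V W P R : ℂ → ℂ} (hV : DifferentiableOn ℂ V disk)
    (hW : DifferentiableOn ℂ W disk) (hP : ∀ z ∈ disk, 0 < (P z).re)
    (hVode : ∀ z ∈ disk, z * deriv V z + P z * V z = R z)
    (hWode : ∀ z ∈ disk, z * deriv W z + P z * W z = R z) : EqOn V W disk := by
  intro z hz
  obtain ⟨z₀, hz₀, hle, hmax⟩ := exists_max_closedBall (g := fun x => ‖V x - W x‖)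
    (hV.sub hW).continuousOn.norm hz
  have h0 : V z₀ - W z₀ = 0 := by
    by_contra hne
    obtain ⟨s, hs, hs'⟩ := exists_nonneg_mul_deriv_eq
      ((hasDerivAt_of_disk hV hz₀).sub (hasDerivAt_of_disk hW hz₀)) hne
      (fun x hx => hmax x (hx.trans hle))
    have h1 : (s + P z₀) * (V z₀ - W z₀) = 0 := by
      have := hs'
      simp only [Pi.sub_apply] at this
      linear_combination hVode z₀ hz₀ - hWode z₀ hz₀ - this
    have h2 : (s + P z₀) ≠ 0 := fun h => by
      have := congrArg Complex.re h
      have := hP z₀ hz₀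
      simp at *
      linarith
    exact (mul_ne_zero h2 hne) h1
  have := hmax z le_rfl
  simp only [h0, norm_zero] at this
  exact sub_eq_zero.1 (norm_le_zero_iff.1 this)

/-! ### Janowski functions and the disks they map onto. -/

theorem one_add_mul_ne_zero {b : ℝ} (hb : |b| ≤ 1) {z : ℂ} (hz : z ∈ disk) :
    (1 + (b : ℂ) * z) ≠ 0 := by
  intro h
  have h1 : ‖(b : ℂ) * z‖ = 1 := by
    rw [show (b : ℂ) * z = -1 by linear_combination h]; simp
  rw [norm_mul, Complex.norm_real, Real.norm_eq_abs] at h1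
  have := mem_disk.1 hz
  nlinarith [norm_nonneg z, abs_nonneg b]

theorem re_one_add_mul_pos {b : ℝ} (hb : |b| ≤ 1) {z : ℂ} (hz : z ∈ disk) :
    0 < (1 + (b : ℂ) * z).re := by
  have h2 : |b * z.re| < 1 := by
    rw [abs_mul]
    have := Complex.abs_re_le_norm z
    have := mem_disk.1 hz
    nlinarith [abs_nonneg b, abs_nonneg z.re]
  have := (abs_lt.1 h2).1
  simp
  linarith

theorem janowski_re_pos {a b : ℝ} (ha : |a| ≤ 1) (hb : |b| ≤ 1) {z : ℂ} (hz : z ∈ disk) :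
    0 < (janowski a b z).re := by
  have hne := one_add_mul_ne_zero hb hz
  have hn := Complex.normSq_pos.2 hne
  unfold janowski
  rw [Complex.div_re, ← add_div]
  apply div_pos _ hn
  simp only [Complex.add_re, Complex.one_re, Complex.mul_re, Complex.ofReal_re, Complex.ofReal_im,
    zero_mul, sub_zero, Complex.add_im, Complex.one_im, Complex.mul_im, add_zero, zero_add]
  have h1 : z.re ^ 2 + z.im ^ 2 < 1 := by
    have h := mem_disk.1 hz
    have h2 : ‖z‖ ^ 2 < 1 := by nlinarith [norm_nonneg z]
    rw [Complex.sq_norm, Complex.normSq_apply] at h2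
    nlinarith
  obtain ⟨ha1, ha2⟩ := abs_le.1 ha
  obtain ⟨hb1, hb2⟩ := abs_le.1 hb
  set x := z.re
  set y := z.im
  have hx : x ^ 2 < 1 := by nlinarith [sq_nonneg y]
  have hx1 : -1 < x := by nlinarith
  have hx2 : x < 1 := by nlinarith
  have e1 : 0 < 1 + 2 * x + (x ^ 2 + y ^ 2) := by nlinarith [sq_nonneg y]
  have e2 : 0 < 1 - (x ^ 2 + y ^ 2) := by linarith
  have e3 : 0 < 1 - 2 * x + (x ^ 2 + y ^ 2) := by nlinarith [sq_nonneg y]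
  -- The numerator 1 + (a+b)x + ab|z|² is affine in a and in b separately, hence bounded below by
  -- its values at a, b = ±1, which are all at least m.
  obtain ⟨m, hm, m1, m2, m3⟩ : ∃ m : ℝ, 0 < m ∧ m ≤ 1 + 2 * x + (x ^ 2 + y ^ 2) ∧
      m ≤ 1 - (x ^ 2 + y ^ 2) ∧ m ≤ 1 - 2 * x + (x ^ 2 + y ^ 2) :=
    ⟨min (min _ _) _, lt_min (lt_min e1 e2) e3, (min_le_left _ _).trans (min_le_left _ _),
      (min_le_left _ _).trans (min_le_right _ _), min_le_right _ _⟩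
  have p1 := mul_le_mul_of_nonneg_left m1 (mul_nonneg (neg_le_iff_add_nonneg'.1 ha1)
    (neg_le_iff_add_nonneg'.1 hb1))
  have p2 := mul_le_mul_of_nonneg_left m2 (mul_nonneg (neg_le_iff_add_nonneg'.1 ha1)
    (sub_nonneg.2 hb2))
  have p3 := mul_le_mul_of_nonneg_left m2 (mul_nonneg (sub_nonneg.2 ha2)
    (neg_le_iff_add_nonneg'.1 hb1))
  have p4 := mul_le_mul_of_nonneg_left m3 (mul_nonneg (sub_nonneg.2 ha2) (sub_nonneg.2 hb2))
  nlinarith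

theorem hasDerivAt_janowski {a b : ℝ} {z : ℂ} (hz : 1 + (b : ℂ) * z ≠ 0) :
    HasDerivAt (janowski a b) ((a - b : ℂ) / (1 + b * z) ^ 2) z := by
  have h1 : HasDerivAt (fun z : ℂ => 1 + (a : ℂ) * z) a z := by
    simpa using ((hasDerivAt_id z).const_mul (a : ℂ)).const_add 1
  have h2 : HasDerivAt (fun z : ℂ => 1 + (b : ℂ) * z) b z := by
    simpa using ((hasDerivAt_id z).const_mul (b : ℂ)).const_add 1
  exact (h1.div h2 hz).congr_deriv (by congr 1; ring)

theorem differentiableOn_janowski {a b : ℝ} (hb : |b| ≤ 1) :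
    DifferentiableOn ℂ (janowski a b) disk := fun _ hz =>
  (hasDerivAt_janowski (one_add_mul_ne_zero hb hz)).differentiableAt.differentiableWithinAt

/-- Centre of the image of the closed disk of radius `R` under `janowski a b`. -/
noncomputable def janowskiCenter (a b R : ℝ) : ℝ := (1 - R ^ 2 * a * b) / (1 - R ^ 2 * b ^ 2)

/-- Radius of the image of the closed disk of radius `R` under `janowski a b`. -/
noncomputable def janowskiRadius (a b R : ℝ) : ℝ := R * |a - b| / (1 - R ^ 2 * b ^ 2)

theorem one_sub_sq_mul_sq_pos {b R : ℝ} (hb : |b| ≤ 1) (hR : 0 ≤ R) (hR1 : R < 1) :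
    0 < 1 - R ^ 2 * b ^ 2 := by
  have h1 : b ^ 2 ≤ 1 := (sq_le_one_iff_abs_le_one b).2 hb
  nlinarith [sq_nonneg b]

/-- Apollonius circle identity: the right-hand side has the sign of ‖x‖ - R when R|b| < 1, so
comparing ‖x‖ with R amounts to comparing the image of x with a circle. -/
theorem norm_add_sq_sub (x : ℂ) (b R : ℝ) :
    ‖x + ((R ^ 2 * b : ℝ) : ℂ)‖ ^ 2 - (R * ‖1 + (b : ℂ) * x‖) ^ 2 =
      (‖x‖ ^ 2 - R ^ 2) * (1 - R ^ 2 * b ^ 2) := by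
  rw [mul_pow]
  simp only [Complex.sq_norm, Complex.normSq_apply, Complex.add_re, Complex.add_im,
    Complex.re_ofReal_mul, Complex.im_ofReal_mul, Complex.ofReal_re, Complex.ofReal_im,
    Complex.one_re, Complex.one_im]
  ring

theorem norm_janowski_sub_center {a b R : ℝ} (hb : |b| ≤ 1) (hR : 0 ≤ R) (hR1 : R < 1)
    {x : ℂ} (hx : 1 + (b : ℂ) * x ≠ 0) :
    ‖janowski a b x - janowskiCenter a b R‖ =
      |a - b| * ‖x + ((R ^ 2 * b : ℝ) : ℂ)‖ / (‖1 + (b : ℂ) * x‖ * (1 - R ^ 2 * b ^ 2)) := by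
  have hpos := one_sub_sq_mul_sq_pos hb hR hR1
  have hne : ((1 - R ^ 2 * b ^ 2 : ℝ) : ℂ) ≠ 0 := by exact_mod_cast hpos.ne'
  have h : janowski a b x - janowskiCenter a b R =
      ((a - b : ℝ) : ℂ) * (x + ((R ^ 2 * b : ℝ) : ℂ)) /
        ((1 + (b : ℂ) * x) * ((1 - R ^ 2 * b ^ 2 : ℝ) : ℂ)) := by
    unfold janowski janowskiCenter
    rw [Complex.ofReal_div, div_sub_div _ _ hx hne]
    congr 1
    push_cast
    ring
  rw [h, norm_div, norm_mul, norm_mul, Complex.norm_real, Complex.norm_real, Real.norm_eq_abs,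
    Real.norm_eq_abs, abs_of_pos hpos]

theorem norm_janowski_sub_center_le_iff {a b R : ℝ} (hab : a ≠ b) (hb : |b| ≤ 1) (hR : 0 ≤ R)
    (hR1 : R < 1) {x : ℂ} (hx : 1 + (b : ℂ) * x ≠ 0) :
    ‖janowski a b x - janowskiCenter a b R‖ ≤ janowskiRadius a b R ↔ ‖x‖ ≤ R := by
  have hpos := one_sub_sq_mul_sq_pos hb hR hR1
  have hn : 0 < ‖1 + (b : ℂ) * x‖ := norm_pos_iff.2 hx
  have habp : 0 < |a - b| := abs_pos.2 (sub_ne_zero.2 hab)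
  rw [norm_janowski_sub_center hb hR hR1 hx, janowskiRadius, div_le_div_iff₀ (by positivity) hpos]
  have h1 := norm_add_sq_sub x b R
  have h2 : |a - b| * ‖x + ((R ^ 2 * b : ℝ) : ℂ)‖ * (1 - R ^ 2 * b ^ 2) ≤
      R * |a - b| * (‖1 + (b : ℂ) * x‖ * (1 - R ^ 2 * b ^ 2)) ↔
      ‖x + ((R ^ 2 * b : ℝ) : ℂ)‖ ≤ R * ‖1 + (b : ℂ) * x‖ := by
    rw [show R * |a - b| * (‖1 + (b : ℂ) * x‖ * (1 - R ^ 2 * b ^ 2)) =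
      (|a - b| * (1 - R ^ 2 * b ^ 2)) * (R * ‖1 + (b : ℂ) * x‖) by ring,
      show |a - b| * ‖x + ((R ^ 2 * b : ℝ) : ℂ)‖ * (1 - R ^ 2 * b ^ 2) =
      (|a - b| * (1 - R ^ 2 * b ^ 2)) * ‖x + ((R ^ 2 * b : ℝ) : ℂ)‖ by ring]
    exact mul_le_mul_iff_right₀ (by positivity)
  rw [h2, ← sq_le_sq₀ (norm_nonneg _) (by positivity), ← sub_nonpos, h1,
    ← sq_le_sq₀ (norm_nonneg x) hR, ← sub_nonpos (a := ‖x‖ ^ 2)]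
  constructor
  · intro h
    by_contra! h'
    have := mul_pos h' hpos
    linarith
  · intro h
    exact mul_nonpos_of_nonpos_of_nonneg h hpos.le

theorem norm_janowski_sub_center_lt {a b R : ℝ} (hab : a ≠ b) (hb : |b| ≤ 1) (hR : 0 < R)
    (hR1 : R < 1) {x : ℂ} (hx : ‖x‖ < R) :
    ‖janowski a b x - janowskiCenter a b R‖ < janowskiRadius a b R := by
  have hpos := one_sub_sq_mul_sq_pos hb hR.le hR1
  have hx0 : 1 + (b : ℂ) * x ≠ 0 := one_add_mul_ne_zero hb (mem_disk.2 (hx.trans hR1))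
  have hn : 0 < ‖1 + (b : ℂ) * x‖ := norm_pos_iff.2 hx0
  have habp : 0 < |a - b| := abs_pos.2 (sub_ne_zero.2 hab)
  rw [norm_janowski_sub_center hb hR.le hR1 hx0, janowskiRadius,
    div_lt_div_iff₀ (by positivity) hpos]
  have h1 := norm_add_sq_sub x b R
  have h2 : ‖x + ((R ^ 2 * b : ℝ) : ℂ)‖ < R * ‖1 + (b : ℂ) * x‖ := by
    rw [← sq_lt_sq₀ (norm_nonneg _) (by positivity), ← sub_neg, h1]
    have : ‖x‖ ^ 2 < R ^ 2 := by gcongr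
    exact mul_neg_of_neg_of_pos (sub_neg.2 this) hpos
  have h3 := mul_lt_mul_of_pos_left h2 (mul_pos habp hpos)
  nlinarith

theorem norm_janowski_sub_center_eq {a b : ℝ} (hb : |b| ≤ 1) {x : ℂ} (hx1 : ‖x‖ < 1)
    (hx : 1 + (b : ℂ) * x ≠ 0) :
    ‖janowski a b x - janowskiCenter a b ‖x‖‖ = janowskiRadius a b ‖x‖ := by
  have hpos := one_sub_sq_mul_sq_pos hb (norm_nonneg x) hx1
  have hn : 0 < ‖1 + (b : ℂ) * x‖ := norm_pos_iff.2 hx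
  have h1 := norm_add_sq_sub x b ‖x‖
  rw [sub_self, zero_mul, sub_eq_zero, sq_eq_sq₀ (norm_nonneg _) (by positivity)] at h1
  rw [norm_janowski_sub_center hb (norm_nonneg x) hx1 hx, janowskiRadius, h1]
  field_simp

/-- The inverse of `janowski a b`. -/
noncomputable def janowskiInv (a b : ℝ) (y : ℂ) : ℂ := (y - 1) / (a - b * y)

theorem janowski_janowskiInv {a b : ℝ} (hab : a ≠ b) {y : ℂ} (hy : (a : ℂ) - b * y ≠ 0) :
    1 + (b : ℂ) * janowskiInv a b y ≠ 0 ∧ janowski a b (janowskiInv a b y) = y := by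
  have hab' : (a : ℂ) - b ≠ 0 := sub_ne_zero.2 (by exact_mod_cast hab)
  have hy' : (a : ℂ) - y * b ≠ 0 := by rwa [mul_comm y]
  have h1 : 1 + (b : ℂ) * janowskiInv a b y = (a - b) / (a - b * y) := by
    unfold janowskiInv
    field_simp
    ring
  have h2 : 1 + (a : ℂ) * janowskiInv a b y = y * (a - b) / (a - b * y) := by
    unfold janowskiInv
    field_simp
    ring
  refine ⟨by rw [h1]; exact div_ne_zero hab' hy, ?_⟩
  rw [janowski, h1, h2]
  field_simp

theorem janowskiInv_janowski {a b : ℝ} (hab : a ≠ b) {x : ℂ} (hx : 1 + (b : ℂ) * x ≠ 0) :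
    (a : ℂ) - b * janowski a b x ≠ 0 ∧ janowskiInv a b (janowski a b x) = x := by
  have hab' : (a : ℂ) - b ≠ 0 := sub_ne_zero.2 (by exact_mod_cast hab)
  have hx' : 1 + x * (b : ℂ) ≠ 0 := by rwa [mul_comm x]
  have h1 : (a : ℂ) - b * janowski a b x = (a - b) / (1 + b * x) := by
    unfold janowski
    field_simp
    ring
  have h2 : janowski a b x - 1 = (a - b) * x / (1 + b * x) := by
    unfold janowski
    field_simp
    ring
  refine ⟨by rw [h1]; exact div_ne_zero hab' hx, ?_⟩
  rw [janowskiInv, h1, h2]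
  field_simp

/-- The pole a/b of the inverse is at distance |a-b| / (|b|(1-R²b²)) from the centre, beyond the
radius because R|b| < 1. -/
theorem sub_mul_ne_zero_of_norm_sub_center_le {a b R : ℝ} (hab : a ≠ b) (hb : |b| ≤ 1)
    (hR : 0 ≤ R) (hR1 : R < 1) {y : ℂ}
    (hy : ‖y - janowskiCenter a b R‖ ≤ janowskiRadius a b R) : (a : ℂ) - b * y ≠ 0 := by
  intro h
  have hpos := one_sub_sq_mul_sq_pos hb hR hR1
  have habp : 0 < |a - b| := abs_pos.2 (sub_ne_zero.2 hab)
  have hb0 : b ≠ 0 := by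
    rintro rfl
    simp at h
    exact hab h
  have hbc : (b : ℂ) ≠ 0 := by exact_mod_cast hb0
  have hne : ((1 - R ^ 2 * b ^ 2 : ℝ) : ℂ) ≠ 0 := by exact_mod_cast hpos.ne'
  have hy' : (b : ℂ) * (y - janowskiCenter a b R) =
      (((a - b) / (1 - R ^ 2 * b ^ 2) : ℝ) : ℂ) := by
    have : (b : ℂ) * y = a := by linear_combination -h
    rw [mul_sub, this, janowskiCenter, Complex.ofReal_div, Complex.ofReal_div]
    rw [eq_div_iff hne, sub_mul, mul_assoc, div_mul_cancel₀ _ hne]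
    push_cast
    ring
  have h1 := congrArg norm hy'
  rw [norm_mul, Complex.norm_real, Complex.norm_real, Real.norm_eq_abs, Real.norm_eq_abs, abs_div,
    abs_of_pos hpos] at h1
  have h2 : |b| * ‖y - janowskiCenter a b R‖ ≤ |b| * janowskiRadius a b R := by gcongr
  rw [h1, janowskiRadius, ← mul_div_assoc, div_le_div_iff_of_pos_right hpos] at h2
  nlinarith [abs_nonneg b, mul_lt_of_lt_one_left habp (a := |b| * R) (by nlinarith [abs_nonneg b])]

theorem norm_janowskiInv_le {a b R : ℝ} (hab : a ≠ b) (hb : |b| ≤ 1)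
    (hR : 0 ≤ R) (hR1 : R < 1) {y : ℂ}
    (hy : ‖y - janowskiCenter a b R‖ ≤ janowskiRadius a b R) :
    ‖janowskiInv a b y‖ ≤ R := by
  obtain ⟨h1, h2⟩ := janowski_janowskiInv hab
    (sub_mul_ne_zero_of_norm_sub_center_le hab hb hR hR1 hy)
  rw [← norm_janowski_sub_center_le_iff hab hb hR hR1 h1, h2]
  exact hy

/-! ### Univalence and inverse functions. -/

/-- Noshiro–Warschawski criterion. -/
theorem injOn_of_re_deriv_pos {s : Set ℂ} (hs : Convex ℝ s) {g g' : ℂ → ℂ}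
    (hg : ∀ y ∈ s, HasDerivAt g (g' y) y) (hpos : ∀ y ∈ s, 0 < (g' y).re) : InjOn g s := by
  intro y₁ h₁ y₂ h₂ heq
  by_contra hne
  have hd : y₂ - y₁ ≠ 0 := sub_ne_zero.2 (Ne.symm hne)
  have hmem : ∀ t ∈ Icc (0 : ℝ) 1, y₁ + t * (y₂ - y₁) ∈ s := by
    intro t ht
    have := hs.add_smul_sub_mem h₁ h₂ ht
    simpa using this
  have hder : ∀ t ∈ Icc (0 : ℝ) 1, HasDerivAt
      (fun t : ℝ => (g (y₁ + t * (y₂ - y₁)) / (y₂ - y₁)).re) (g' (y₁ + t * (y₂ - y₁))).re t := by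
    intro t ht
    have h1 : HasDerivAt (fun t : ℝ => y₁ + (t : ℂ) * (y₂ - y₁)) (1 * (y₂ - y₁)) t :=
      ((Complex.ofRealCLM.hasDerivAt (x := t)).mul_const (y₂ - y₁)).const_add y₁
    have h2 := ((hg _ (hmem t ht)).comp t h1).div_const (y₂ - y₁)
    have h3 := Complex.reCLM.hasFDerivAt.comp_hasDerivAt t h2
    refine h3.congr_deriv ?_
    simp [mul_div_assoc, div_self hd]
  have hmono : StrictMonoOn (fun t : ℝ => (g (y₁ + t * (y₂ - y₁)) / (y₂ - y₁)).re) (Icc 0 1) := by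
    refine strictMonoOn_of_deriv_pos (convex_Icc 0 1)
      (fun t ht => (hder t ht).continuousAt.continuousWithinAt) fun t ht => ?_
    rw [interior_Icc] at ht
    rw [(hder t (Ioo_subset_Icc_self ht)).deriv]
    exact hpos _ (hmem t (Ioo_subset_Icc_self ht))
  have := hmono (left_mem_Icc.2 zero_le_one) (right_mem_Icc.2 zero_le_one) zero_lt_one
  simp [heq] at this

/-- The inverse of an injective analytic function with nonvanishing derivative. -/
theorem hasDerivAt_invFunOn {f : ℂ → ℂ} {s : Set ℂ} (hs : IsOpen s)
    (hf : DifferentiableOn ℂ f s) (hinj : InjOn f s) (hd : ∀ z ∈ s, deriv f z ≠ 0) :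
    IsOpen (f '' s) ∧ ∀ z ∈ s, HasDerivAt (Function.invFunOn f s) (deriv f z)⁻¹ (f z) := by
  have hstrict : ∀ z ∈ s, HasStrictDerivAt f (deriv f z) z := fun z hz =>
    (hf.analyticAt (hs.mem_nhds hz)).hasStrictDerivAt
  have hmap : ∀ z ∈ s, map f (𝓝 z) = 𝓝 (f z) := fun z hz =>
    (hstrict z hz).map_nhds_eq (hd z hz)
  have hopen : IsOpen (f '' s) := by
    rw [isOpen_iff_mem_nhds]
    rintro _ ⟨z, hz, rfl⟩
    rw [← hmap z hz]
    exact image_mem_map (hs.mem_nhds hz)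
  refine ⟨hopen, fun z hz => ?_⟩
  have hleft : ∀ x ∈ s, Function.invFunOn f s (f x) = x := fun x hx =>
    hinj.leftInvOn_invFunOn hx
  have hcont : ContinuousAt (Function.invFunOn f s) (f z) := by
    intro N hN
    rw [hleft z hz] at hN
    rw [mem_map, ← hmap z hz]
    refine mem_of_superset (image_mem_map (inter_mem hN (hs.mem_nhds hz))) ?_
    rintro _ ⟨x, ⟨hxN, hxs⟩, rfl⟩
    simpa [hleft x hxs] using hxN
  refine HasDerivAt.of_local_left_inverse (f := f) hcont ?_ (hd z hz) ?_
  · rw [hleft z hz]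
    exact (hstrict z hz).hasDerivAt
  · filter_upwards [hopen.mem_nhds (mem_image_of_mem f hz)] with y hy
    exact Function.invFunOn_eq hy

/-! ### The Briot–Bouquet equation and its univalent solution. -/

/-- `V` is the reciprocal of the analytic solution of the Briot–Bouquet equation
`q + z q' / (κ q) = h` with `h = janowski a b`. -/
structure IsBriotBouquetRecip (κ a b : ℝ) (V : ℂ → ℂ) : Prop where
  kappa_pos : 0 < κ
  abs_left : |a| ≤ 1
  abs_right : |b| ≤ 1
  ne : a ≠ b
  diff : DifferentiableOn ℂ V disk
  ode : ∀ z ∈ disk, z * deriv V z + κ * janowski a b z * V z = κ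

namespace IsBriotBouquetRecip

variable {κ a b : ℝ} {V : ℂ → ℂ}

theorem kappa_ne (h : IsBriotBouquetRecip κ a b V) : (κ : ℂ) ≠ 0 := by
  exact_mod_cast h.kappa_pos.ne'

theorem re_pos (h : IsBriotBouquetRecip κ a b V) {z : ℂ} (hz : z ∈ disk) : 0 < (V z).re := by
  have hκ := h.kappa_ne
  have h1 : 0 < (V z / κ).re := by
    refine re_pos_of_linear_ode (V := fun z => V z / κ) (P := fun z => κ * janowski a b z)
      (h.diff.div_const _) (fun z hz => ?_) (fun z hz => ?_) hz
    · rw [Complex.re_ofReal_mul]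
      exact mul_pos h.kappa_pos (janowski_re_pos h.abs_left h.abs_right hz)
    · rw [deriv_div_const]
      have := h.ode z hz
      field_simp
      linear_combination this
  rw [Complex.div_ofReal_re] at h1
  exact (div_pos_iff_of_pos_right h.kappa_pos).1 h1

theorem ne_zero (h : IsBriotBouquetRecip κ a b V) {z : ℂ} (hz : z ∈ disk) : V z ≠ 0 := fun h0 => by
  have := h.re_pos hz
  simp [h0] at this

theorem apply_zero (h : IsBriotBouquetRecip κ a b V) : V 0 = 1 := by
  have := h.ode 0 zero_mem_disk
  simpa [janowski, h.kappa_ne] using this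

theorem differentiableOn_inv (h : IsBriotBouquetRecip κ a b V) :
    DifferentiableOn ℂ (fun z => (V z)⁻¹) disk :=
  h.diff.inv fun _ hz => h.ne_zero hz

theorem mul_deriv_inv (h : IsBriotBouquetRecip κ a b V) {z : ℂ} (hz : z ∈ disk) :
    z * deriv (fun z => (V z)⁻¹) z = κ * (V z)⁻¹ * (janowski a b z - (V z)⁻¹) := by
  have hV := h.ne_zero hz
  rw [((hasDerivAt_of_disk h.diff hz).fun_inv hV).deriv]
  have := h.ode z hz
  field_simp
  linear_combination -this

/-- The solution is subordinate to `janowski a b`. -/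
theorem exists_inv_eq_janowski (h : IsBriotBouquetRecip κ a b V) {z : ℂ} (hz : z ∈ disk) :
    ∃ x : ℂ, ‖x‖ ≤ ‖z‖ ∧ (V z)⁻¹ = janowski a b x := by
  set R := ‖z‖ with hR
  have hR0 : 0 ≤ R := norm_nonneg z
  have hR1 : R < 1 := mem_disk.1 hz
  have hκ := h.kappa_pos
  -- As 1/h = `janowski b a`, it suffices to place V in the disk that is the image of ‖x‖ ≤ R under
  -- 1/h.
  set c := janowskiCenter b a R with hc
  set r := janowskiRadius b a R with hr
  have hVc : ‖V z - c‖ ≤ r := by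
    obtain ⟨z₀, hz₀, hle, hmax⟩ := exists_max_closedBall (g := fun x => ‖V x - c‖)
      (h.diff.sub_const _).continuousOn.norm hz
    refine (hmax z le_rfl).trans ?_
    have hj : ‖janowski b a z₀ - c‖ ≤ r :=
      (norm_janowski_sub_center_le_iff h.ne.symm h.abs_left hR0 hR1
        (one_add_mul_ne_zero h.abs_left hz₀)).2 hle
    rcases eq_or_ne (V z₀ - c) 0 with h0 | h0
    · simp only [h0, norm_zero]
      exact (norm_nonneg _).trans hj
    obtain ⟨s, hs, hs'⟩ := exists_nonneg_mul_deriv_eq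
      ((hasDerivAt_of_disk h.diff hz₀).sub_const (c : ℂ)) h0 (fun x hx => hmax x (hx.trans hle))
    set D := V z₀ - c with hD
    set k := janowski b a z₀ with hk
    have hkj : k * janowski a b z₀ = 1 := by
      have h1 := one_add_mul_ne_zero h.abs_left hz₀
      have h2 := one_add_mul_ne_zero h.abs_right hz₀
      rw [hk, janowski, janowski, div_mul_div_comm, mul_comm, div_self (mul_ne_zero h1 h2)]
    have hode := h.ode z₀ hz₀
    have hκc := h.kappa_ne
    have e1 : D = (k - c) - ((s / κ : ℝ) : ℂ) * k * D := by
      have : V z₀ = k - ((s / κ : ℝ) : ℂ) * k * D := by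
        push_cast
        field_simp
        linear_combination k * hode - κ * V z₀ * hkj - k * hs'
      linear_combination this + hD
    -- After multiplication by conj D and passage to real parts, the s-term has a favourable sign
    -- because Re k > 0, leaving |D|² ≤ r|D|.
    have e2 : D * conj D = (k - c) * conj D - ((s / κ : ℝ) : ℂ) * k * (D * conj D) := by
      linear_combination conj D * e1
    rw [Complex.mul_conj'] at e2
    have e3 := congrArg Complex.re e2
    have e4 : ((k - c) * conj D).re ≤ r * ‖D‖ := by
      calc ((k - c) * conj D).re ≤ ‖(k - c) * conj D‖ := Complex.re_le_norm _
        _ = ‖k - c‖ * ‖D‖ := by simp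
        _ ≤ r * ‖D‖ := by gcongr
    have e5 : (((s / κ : ℝ) : ℂ) * k * (‖D‖ : ℂ) ^ 2).re = s / κ * k.re * ‖D‖ ^ 2 := by
      rw [← Complex.ofReal_pow, Complex.re_mul_ofReal, Complex.re_ofReal_mul]
    have e6 : 0 < k.re := janowski_re_pos h.abs_right h.abs_left hz₀
    rw [Complex.sub_re, e5, ← Complex.ofReal_pow, Complex.ofReal_re] at e3
    have e7 : 0 ≤ s / κ * k.re * ‖D‖ ^ 2 := by positivity
    have e8 : 0 < ‖D‖ := norm_pos_iff.2 h0
    have e9 : ‖D‖ * ‖D‖ ≤ r * ‖D‖ := by nlinarith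
    exact le_of_mul_le_mul_right e9 e8
  obtain ⟨h1, h2⟩ := janowski_janowskiInv h.ne.symm
    (sub_mul_ne_zero_of_norm_sub_center_le h.ne.symm h.abs_left hR0 hR1 hVc)
  refine ⟨_, norm_janowskiInv_le h.ne.symm h.abs_left hR0 hR1 hVc, ?_⟩
  conv_lhs => rw [← h2]
  rw [janowski, janowski, inv_div]

theorem subordinate_janowski (h : IsBriotBouquetRecip κ a b V) :
    Subordinate (fun z => (V z)⁻¹) (janowski a b) := by
  have key : ∀ z ∈ disk, (a : ℂ) - b * (V z)⁻¹ ≠ 0 ∧ ‖janowskiInv a b (V z)⁻¹‖ ≤ ‖z‖ ∧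
      janowski a b (janowskiInv a b (V z)⁻¹) = (V z)⁻¹ := by
    intro z hz
    obtain ⟨x, hx, hx'⟩ := h.exists_inv_eq_janowski hz
    have hxd : x ∈ disk := mem_disk.2 (hx.trans_lt (mem_disk.1 hz))
    obtain ⟨h1, h2⟩ := janowskiInv_janowski h.ne (one_add_mul_ne_zero h.abs_right hxd)
    rw [hx', h2]
    exact ⟨h1, hx, rfl⟩
  refine ⟨h.differentiableOn_inv, differentiableOn_janowski h.abs_right,
    fun z => janowskiInv a b (V z)⁻¹, ?_, ?_, ?_, fun z hz => (key z hz).2.2.symm⟩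
  · exact (h.differentiableOn_inv.sub_const 1).div
      ((differentiableOn_const _).sub (h.differentiableOn_inv.const_mul _))
      fun z hz => (key z hz).1
  · simp [h.apply_zero, janowskiInv]
  · exact fun z hz => mem_disk.2 ((key z hz).2.1.trans_lt (mem_disk.1 hz))

/-- The quantity is the derivative of -log V ∘ h⁻¹ at h(z). Differentiating the equation for V shows
that its quotient by κ solves z W' + P W = 1 with P = (1-bz)/(1+bz) + κ/V, and both summands of P
have positive real part. -/
theorem re_logDeriv_pos (h : IsBriotBouquetRecip κ a b V) {z : ℂ} (hz : z ∈ disk) :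
    0 < (-(deriv V z * (1 + b * z) ^ 2) / ((a - b) * V z)).re := by
  have hab : (a : ℂ) - b ≠ 0 := sub_ne_zero.2 (by exact_mod_cast h.ne)
  have hκ := h.kappa_ne
  have hκr := h.kappa_pos
  have hV' : DifferentiableOn ℂ (deriv V) disk := h.diff.deriv isOpen_disk
  set W : ℂ → ℂ := fun z => -(deriv V z * (1 + b * z) ^ 2) / (κ * (a - b) * V z) with hW
  have hWd : ∀ z ∈ disk, HasDerivAt W
      (((-(deriv (deriv V) z * (1 + b * z) ^ 2 + deriv V z * (2 * (1 + b * z) * b))) *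
        (κ * (a - b) * V z) - (-(deriv V z * (1 + b * z) ^ 2)) * (κ * (a - b) * deriv V z)) /
        (κ * (a - b) * V z) ^ 2) z := by
    intro z hz
    have h2 : HasDerivAt (fun z : ℂ => 1 + (b : ℂ) * z) b z := by
      simpa using ((hasDerivAt_id z).const_mul (b : ℂ)).const_add 1
    have h3 : HasDerivAt (fun z : ℂ => (1 + (b : ℂ) * z) ^ 2) (2 * (1 + b * z) * b) z := by
      simpa using h2.fun_pow 2
    exact (((hasDerivAt_of_disk hV' hz).mul h3).neg).div
      ((hasDerivAt_of_disk h.diff hz).const_mul _)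
      (mul_ne_zero (mul_ne_zero hκ hab) (h.ne_zero hz))
  have hpos : 0 < (W z).re := by
    refine re_pos_of_linear_ode (V := W) (P := fun z => janowski (-b) b z + κ * (V z)⁻¹)
      (fun z hz => (hWd z hz).differentiableAt.differentiableWithinAt) (fun z hz => ?_)
      (fun z hz => ?_) hz
    · have h1 := janowski_re_pos (a := -b) (by simpa using h.abs_right) h.abs_right hz
      have h2 : 0 < ((V z)⁻¹).re := by
        rw [Complex.inv_re]
        exact div_pos (h.re_pos hz) (Complex.normSq_pos.2 (h.ne_zero hz))
      rw [Complex.add_re, Complex.re_ofReal_mul]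
      positivity
    · have hV := h.ne_zero hz
      have hb := one_add_mul_ne_zero h.abs_right hz
      have hb' : 1 + z * (b : ℂ) ≠ 0 := by rwa [mul_comm z]
      have hode := h.ode z hz
      have hode2 : deriv V z + z * deriv (deriv V) z +
          (κ * ((a - b) / (1 + b * z) ^ 2) * V z + κ * janowski a b z * deriv V z) = 0 := by
        have h1 : HasDerivAt (fun z => z * deriv V z + κ * janowski a b z * V z)
            (1 * deriv V z + z * deriv (deriv V) z +
              (κ * ((a - b) / (1 + b * z) ^ 2) * V z + κ * janowski a b z * deriv V z)) z :=
          ((hasDerivAt_id z).mul (hasDerivAt_of_disk hV' hz)).add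
            (((hasDerivAt_janowski hb).const_mul _).mul (hasDerivAt_of_disk h.diff hz))
        have h2 : HasDerivAt (fun z => z * deriv V z + κ * janowski a b z * V z) 0 z := by
          refine (hasDerivAt_const z (κ : ℂ)).congr_of_eventuallyEq ?_
          filter_upwards [isOpen_disk.mem_nhds hz] with y hy using h.ode y hy
        rw [← h1.unique h2]
        ring
      rw [(hWd z hz).deriv, hW]
      simp only [janowski] at hode hode2 ⊢
      generalize deriv (deriv V) z = V2 at *
      generalize deriv V z = V1 at *
      generalize V z = V0 at *
      push_cast
      have hode' : z * V1 * (1 + b * z) + κ * (1 + a * z) * V0 = κ * (1 + b * z) := by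
        field_simp at hode
        linear_combination hode
      have hode2' : (V1 + z * V2) * (1 + b * z) ^ 2 + κ * (a - b) * V0 +
          κ * (1 + a * z) * (1 + b * z) * V1 = 0 := by
        field_simp at hode2
        linear_combination hode2
      field_simp
      linear_combination V1 * (1 + b * z) * hode' - V0 * hode2'
  have : W z = (-(deriv V z * (1 + b * z) ^ 2) / ((a - b) * V z)) / κ := by
    rw [hW, div_div]
    ring
  rw [this, Complex.div_ofReal_re] at hpos
  exact (div_pos_iff_of_pos_right hκr).1 hpos

theorem deriv_ne_zero (h : IsBriotBouquetRecip κ a b V) {z : ℂ} (hz : z ∈ disk) :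
    deriv V z ≠ 0 := fun h0 => by
  have := h.re_logDeriv_pos hz
  simp [h0] at this

/-- In the coordinate y = h(x), a closed disk containing both points becomes a convex set on which
-log V has derivative of positive real part, so the Noshiro–Warschawski criterion applies. -/
theorem injOn (h : IsBriotBouquetRecip κ a b V) : InjOn V disk := by
  intro z₁ h₁ z₂ h₂ heq
  set R := max ‖z₁‖ ‖z₂‖ with hR
  have hR0 : 0 ≤ R := le_max_of_le_left (norm_nonneg _)
  have hR1 : R < 1 := max_lt (mem_disk.1 h₁) (mem_disk.1 h₂)
  have hab : (a : ℂ) - b ≠ 0 := sub_ne_zero.2 (by exact_mod_cast h.ne)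
  set K := Metric.closedBall (janowskiCenter a b R : ℂ) (janowskiRadius a b R) with hK
  have hmem : ∀ z, ‖z‖ ≤ R → janowski a b z ∈ K := by
    intro z hz
    rw [hK, mem_closedBall_iff_norm]
    exact (norm_janowski_sub_center_le_iff h.ne h.abs_right hR0 hR1
      (one_add_mul_ne_zero h.abs_right (mem_disk.2 (hz.trans_lt hR1)))).2 hz
  have hinj : InjOn (fun y => -Complex.log (V (janowskiInv a b y))) K := by
    refine injOn_of_re_deriv_pos (g' := fun y => -(deriv V (janowskiInv a b y) *
      (1 + b * janowskiInv a b y) ^ 2) / ((a - b) * V (janowskiInv a b y)))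
      (convex_closedBall _ _) (fun y hy => ?_) (fun y hy => ?_)
    · rw [mem_closedBall_iff_norm] at hy
      have hd : janowskiInv a b y ∈ disk :=
        mem_disk.2 ((norm_janowskiInv_le h.ne h.abs_right hR0 hR1 hy).trans_lt hR1)
      have hy0 := sub_mul_ne_zero_of_norm_sub_center_le h.ne h.abs_right hR0 hR1 hy
      have hk : HasDerivAt (janowskiInv a b)
          ((1 * (a - b * y) - (y - 1) * (-(b * 1))) / (a - b * y) ^ 2) y :=
        ((hasDerivAt_id y).sub_const 1).div (((hasDerivAt_id y).const_mul (b : ℂ)).const_sub _) hy0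
      have hc := (((hasDerivAt_of_disk h.diff hd).comp y hk).clog
        (Or.inl (h.re_pos hd))).neg
      refine hc.congr_deriv ?_
      have hV := h.ne_zero hd
      have h1 : 1 + (b : ℂ) * janowskiInv a b y = (a - b) / (a - b * y) := by
        have hy' : (a : ℂ) - y * b ≠ 0 := by rwa [mul_comm y]
        unfold janowskiInv
        field_simp
        ring
      rw [h1]
      simp only [Function.comp]
      generalize deriv V (janowskiInv a b y) = V1
      generalize V (janowskiInv a b y) = V0 at *
      field_simp
      ring
    · rw [mem_closedBall_iff_norm] at hy
      exact h.re_logDeriv_pos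
        (mem_disk.2 ((norm_janowskiInv_le h.ne h.abs_right hR0 hR1 hy).trans_lt hR1))
  have e1 := (janowskiInv_janowski h.ne (one_add_mul_ne_zero h.abs_right h₁)).2
  have e2 := (janowskiInv_janowski h.ne (one_add_mul_ne_zero h.abs_right h₂)).2
  have := hinj (hmem z₁ (le_max_left _ _)) (hmem z₂ (le_max_right _ _))
    (by simp only [e1, e2, heq])
  rw [← e1, ← e2, this]

theorem injOn_inv (h : IsBriotBouquetRecip κ a b V) : InjOn (fun z => (V z)⁻¹) disk :=
  fun _ h₁ _ h₂ heq => h.injOn h₁ h₂ (inv_injective heq)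

theorem deriv_inv_ne_zero (h : IsBriotBouquetRecip κ a b V) {z : ℂ} (hz : z ∈ disk) :
    deriv (fun z => (V z)⁻¹) z ≠ 0 := by
  rw [((hasDerivAt_of_disk h.diff hz).fun_inv (h.ne_zero hz)).deriv]
  exact div_ne_zero (neg_ne_zero.2 (h.deriv_ne_zero hz)) (pow_ne_zero _ (h.ne_zero hz))

end IsBriotBouquetRecip
-- Dominance: lifting solutions of the subordination through q.
namespace IsBriotBouquetRecip

variable {κ a b : ℝ} {V : ℂ → ℂ}

/-- If the values of an analytic solution `φ` of `z φ' = κ φ (h ∘ w - φ)` on the closed disk of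
radius `ρ` are values of `q = 1 / V` in the disk, then `q⁻¹ ∘ φ` does not increase the modulus. -/
theorem norm_lift_le (h : IsBriotBouquetRecip κ a b V) {φ w ω : ℂ → ℂ}
    (hw : ∀ z ∈ disk, ‖w z‖ ≤ ‖z‖)
    (hode : ∀ z ∈ disk, z * deriv φ z = κ * φ z * (janowski a b (w z) - φ z))
    {O : Set ℂ} (hO : IsOpen O) (hOd : O ⊆ disk) (hω : DifferentiableOn ℂ ω O) (hω0 : ω 0 = 0)
    (hωd : MapsTo ω O disk) (hφω : ∀ z ∈ O, φ z = (V (ω z))⁻¹)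
    {ρ : ℝ} (hρ : 0 < ρ) (hρO : Metric.closedBall 0 ρ ⊆ O) {z : ℂ} (hz : ‖z‖ ≤ ρ) :
    ‖ω z‖ ≤ ‖z‖ := by
  have h0O : (0 : ℂ) ∈ O := hρO (by simp [hρ.le])
  -- The maximum principle is applied to ω(z)/z rather than ω, so that Jack's lemma yields z₀ω' =
  -- (1+s)ω with a factor at least 1.
  have hv : DifferentiableOn ℂ (dslope ω 0) O :=
    (Complex.differentiableOn_dslope (hO.mem_nhds h0O)).2 hω
  have hbr : closure (Metric.ball (0 : ℂ) ρ) = Metric.closedBall 0 ρ := closure_ball _ hρ.ne'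
  obtain ⟨z₀, hz₀, hmax⟩ := Complex.exists_mem_frontier_isMaxOn_norm
    (f := dslope ω 0) (U := Metric.ball (0 : ℂ) ρ) Metric.isBounded_ball ⟨0, by simp [hρ]⟩
    (DifferentiableOn.diffContOnCl (by rw [hbr]; exact hv.mono hρO))
  rw [frontier_ball _ hρ.ne', mem_sphere_zero_iff_norm] at hz₀
  rw [hbr] at hmax
  have hz₀O : z₀ ∈ O := hρO (by simp [hz₀])
  have hz₀d : z₀ ∈ disk := hOd hz₀O
  have hz₀0 : z₀ ≠ 0 := norm_pos_iff.1 (hz₀ ▸ hρ)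
  have hmax' : ∀ x, ‖x‖ ≤ ‖z₀‖ → ‖dslope ω 0 x‖ ≤ ‖dslope ω 0 z₀‖ := fun x hx =>
    hmax (by simpa [hz₀] using hx)
  have hds : ∀ x, x ≠ 0 → dslope ω 0 x = ω x / x := fun x hx => by
    rw [dslope_of_ne _ hx, slope_def_field, hω0, sub_zero, sub_zero]
  have hρ1 : ρ < 1 := hz₀ ▸ mem_disk.1 hz₀d
  have hmain : ‖ω z₀‖ ≤ ρ := by
    by_contra! hlt
    have hω₀ : ω z₀ ≠ 0 := norm_pos_iff.1 (hρ.trans hlt)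
    have hωat : HasDerivAt ω (deriv ω z₀) z₀ :=
      (hω.differentiableAt (hO.mem_nhds hz₀O)).hasDerivAt
    have hvat : HasDerivAt (dslope ω 0) ((deriv ω z₀ * z₀ - ω z₀ * 1) / z₀ ^ 2) z₀ := by
      refine (hωat.div (hasDerivAt_id z₀) hz₀0).congr_of_eventuallyEq ?_
      filter_upwards [isOpen_ne.mem_nhds hz₀0] with x hx using hds x hx
    obtain ⟨s, hs, hs'⟩ := exists_nonneg_mul_deriv_eq hvat
      (by rw [hds _ hz₀0]; exact div_ne_zero hω₀ hz₀0) hmax'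
    have e1 : z₀ * deriv ω z₀ = (1 + s) * ω z₀ := by
      rw [hds _ hz₀0] at hs'
      field_simp at hs'
      linear_combination hs'
    set y := ω z₀ with hy
    have hyd : y ∈ disk := hωd hz₀O
    have hφ' : deriv φ z₀ = deriv (fun z => (V z)⁻¹) y * deriv ω z₀ := by
      have h1 := (hasDerivAt_of_disk h.differentiableOn_inv hyd).comp z₀ hωat
      refine (h1.congr_of_eventuallyEq ?_).deriv
      filter_upwards [hO.mem_nhds hz₀O] with x hx using hφω x hx
    have hVy : (V y)⁻¹ ≠ 0 := inv_ne_zero (h.ne_zero hyd)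
    -- Comparing the equations of φ at z₀ and of q at y expresses h(y) as the convex combination
    -- (h(w z₀) + s q(y))/(1+s).
    have e2 : janowski a b (w z₀) - (V y)⁻¹ = (1 + s) * (janowski a b y - (V y)⁻¹) := by
      have h1 := hode z₀ hz₀d
      rw [hφ', hφω z₀ hz₀O] at h1
      have h2 := h.mul_deriv_inv hyd
      have h3 : (κ : ℂ) * (V y)⁻¹ ≠ 0 := mul_ne_zero h.kappa_ne hVy
      apply mul_left_cancel₀ h3
      linear_combination -h1 + deriv (fun z => (V z)⁻¹) y * e1 + (1 + s) * h2
    set R := ‖y‖ with hR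
    have hR0 : 0 < R := hρ.trans hlt
    have hR1 : R < 1 := mem_disk.1 hyd
    set c : ℂ := (janowskiCenter a b R : ℂ)
    have f1 : ‖janowski a b (w z₀) - c‖ < janowskiRadius a b R :=
      norm_janowski_sub_center_lt h.ne h.abs_right hR0 hR1
        (((hw z₀ hz₀d).trans_eq hz₀).trans_lt hlt)
    obtain ⟨x, hx, hx'⟩ := h.exists_inv_eq_janowski hyd
    have f2 : ‖(V y)⁻¹ - c‖ ≤ janowskiRadius a b R := by
      rw [hx']
      exact (norm_janowski_sub_center_le_iff h.ne h.abs_right hR0.le hR1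
        (one_add_mul_ne_zero h.abs_right (mem_disk.2 (hx.trans_lt hR1)))).2 hx
    have f3 : ‖janowski a b y - c‖ < janowskiRadius a b R := by
      have e3 : ((1 + s : ℝ) : ℂ) * (janowski a b y - c) =
          (janowski a b (w z₀) - c) + (s : ℂ) * ((V y)⁻¹ - c) := by
        push_cast
        linear_combination -e2
      have e4 := congrArg norm e3
      rw [norm_mul, Complex.norm_real, Real.norm_of_nonneg (by linarith)] at e4
      have e5 := norm_add_le (janowski a b (w z₀) - c) ((s : ℂ) * ((V y)⁻¹ - c))
      rw [norm_mul, Complex.norm_real, Real.norm_of_nonneg hs] at e5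
      have e6 := mul_le_mul_of_nonneg_left f2 hs
      by_contra! hge
      nlinarith
    -- Since ‖y‖ = R, the point h(y) lies exactly on the boundary circle.
    exact f3.ne (norm_janowski_sub_center_eq h.abs_right hR1
      (one_add_mul_ne_zero h.abs_right hyd))
  rcases eq_or_ne z 0 with rfl | hz0
  · simp [hω0]
  · have h1 := hmax' z (hz.trans_eq hz₀.symm)
    rw [hds _ hz0, hds _ hz₀0, norm_div, norm_div, hz₀] at h1
    have h2 : ‖ω z₀‖ / ρ ≤ 1 := div_le_one_of_le₀ hmain hρ.le
    exact (div_le_one (norm_pos_iff.2 hz0)).1 (h1.trans h2)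

/-- The solution dominates all solutions of the Briot–Bouquet differential subordination. -/
theorem subordinate_inv (h : IsBriotBouquetRecip κ a b V) {φ w : ℂ → ℂ}
    (hφ : DifferentiableOn ℂ φ disk) (hφ0 : φ 0 = 1)
    (hw : DifferentiableOn ℂ w disk) (hw0 : w 0 = 0) (hwm : MapsTo w disk disk)
    (hode : ∀ z ∈ disk, z * deriv φ z = κ * φ z * (janowski a b (w z) - φ z)) :
    Subordinate φ (fun z => (V z)⁻¹) := by
  have hwn : ∀ z ∈ disk, ‖w z‖ ≤ ‖z‖ := fun z hz =>
    Complex.norm_le_norm_of_mapsTo_ball hw (hwm.mono_right Metric.ball_subset_closedBall) hw0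
      (mem_disk.1 hz)
  set q : ℂ → ℂ := fun z => (V z)⁻¹ with hq
  obtain ⟨hGo, hψ⟩ := hasDerivAt_invFunOn isOpen_disk h.differentiableOn_inv h.injOn_inv
    (fun z hz => h.deriv_inv_ne_zero hz)
  set ψ := Function.invFunOn q disk with hψdef
  set O := disk ∩ φ ⁻¹' (q '' disk) with hOdef
  have hO : IsOpen O := hφ.continuousOn.isOpen_inter_preimage isOpen_disk hGo
  have hq0 : q 0 = 1 := by simp [hq, h.apply_zero]
  have hleft : ∀ x ∈ disk, ψ (q x) = x := fun x hx => h.injOn_inv.leftInvOn_invFunOn hx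
  have hωd : MapsTo (fun z => ψ (φ z)) O disk := fun z hz => Function.invFunOn_mem hz.2
  have hφω : ∀ z ∈ O, φ z = q (ψ (φ z)) := fun z hz => (Function.invFunOn_eq hz.2).symm
  have hω0 : ψ (φ 0) = 0 := by rw [hφ0, ← hq0]; exact hleft 0 zero_mem_disk
  have hω : DifferentiableOn ℂ (fun z => ψ (φ z)) O := by
    rintro z ⟨hz, x, hx, hx'⟩
    have h1 : HasDerivAt ψ _ (q x) := hψ x hx
    rw [hx'] at h1
    exact (h1.comp z (hasDerivAt_of_disk hφ hz)).differentiableAt.differentiableWithinAt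
  have h0O : (0 : ℂ) ∈ O := ⟨zero_mem_disk, 0, zero_mem_disk, by rw [hφ0, hq0]⟩
  have hall : disk ⊆ O := by
    by_contra hcon
    obtain ⟨z₁, hz₁, hz₁O⟩ := not_subset.1 hcon
    have hK : IsCompact (Metric.closedBall (0 : ℂ) ‖z₁‖ \ O) :=
      (isCompact_closedBall _ _).diff hO
    -- A point of least modulus where φ leaves the image of q. Below that modulus the lift exists
    -- and is bounded by ‖z₂‖, so by compactness φ(z₂) is still in the image, a contradiction.
    obtain ⟨z₂, ⟨hz₂, hz₂O⟩, hmin⟩ := hK.exists_isMinOn ⟨z₁, by simp, hz₁O⟩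
      continuous_norm.continuousOn
    have hz₂' : ‖z₂‖ ≤ ‖z₁‖ := by simpa using hz₂
    have hz₂d : z₂ ∈ disk := mem_disk.2 (hz₂'.trans_lt (mem_disk.1 hz₁))
    have hz₂0 : z₂ ≠ 0 := fun h0 => hz₂O (h0 ▸ h0O)
    have hball : ∀ z, ‖z‖ < ‖z₂‖ → z ∈ O := by
      intro z hz
      by_contra hzO
      have : ‖z₂‖ ≤ ‖z‖ := hmin ⟨by simpa using hz.le.trans hz₂', hzO⟩
      linarith
    have hnorm : ∀ z, ‖z‖ < ‖z₂‖ → ‖ψ (φ z)‖ ≤ ‖z₂‖ := by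
      intro z hz
      obtain ⟨ρ, hρ1, hρ2⟩ := exists_between hz
      refine (h.norm_lift_le hwn hode hO inter_subset_left hω hω0 hωd hφω
        ((norm_nonneg z).trans_lt hρ1) (fun x hx => hball x ?_) hρ1.le).trans hz.le
      exact (mem_closedBall_zero_iff.1 hx).trans_lt hρ2
    have hcomp : IsClosed (q '' Metric.closedBall 0 ‖z₂‖) := by
      refine ((isCompact_closedBall _ _).image_of_continuousOn
        (h.differentiableOn_inv.continuousOn.mono fun x hx => ?_)).isClosed
      exact mem_disk.2 ((mem_closedBall_zero_iff.1 hx).trans_lt (mem_disk.1 hz₂d))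
    have hmemb : φ z₂ ∈ q '' Metric.closedBall 0 ‖z₂‖ := by
      have hlim : Tendsto (fun t : ℝ => φ ((t : ℂ) * z₂)) (𝓝[<] 1) (𝓝 (φ z₂)) := by
        have h1 : Tendsto (fun t : ℝ => (t : ℂ) * z₂) (𝓝[<] 1) (𝓝 z₂) := by
          have : Continuous fun t : ℝ => (t : ℂ) * z₂ := by fun_prop
          simpa using (this.tendsto 1).mono_left nhdsWithin_le_nhds
        exact ((hasDerivAt_of_disk hφ hz₂d).continuousAt.tendsto).comp h1
      refine hcomp.mem_of_tendsto hlim ?_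
      filter_upwards [Ioo_mem_nhdsLT (show (0 : ℝ) < 1 by norm_num)] with t ht
      have ht' : ‖(t : ℂ) * z₂‖ < ‖z₂‖ := by
        rw [norm_mul, Complex.norm_real, Real.norm_of_nonneg ht.1.le]
        exact mul_lt_of_lt_one_left (norm_pos_iff.2 hz₂0) ht.2
      exact ⟨_, by simpa using hnorm _ ht', (hφω _ (hball _ ht')).symm⟩
    obtain ⟨x, hx, hx'⟩ := hmemb
    exact hz₂O ⟨hz₂d, x, mem_disk.2 ((mem_closedBall_zero_iff.1 hx).trans_lt (mem_disk.1 hz₂d)), hx'⟩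
  exact ⟨hφ, h.differentiableOn_inv, fun z => ψ (φ z), hω.mono hall, hω0, hωd.mono_left hall,
    fun z hz => hφω z (hall hz)⟩

end IsBriotBouquetRecip

/-! ### Bernardi-type integrals and the explicit solution Q. -/

theorem ofReal_mul_mem_disk {t : ℝ} (ht : t ∈ Icc (0 : ℝ) 1) {z : ℂ} (hz : z ∈ disk) :
    (t : ℂ) * z ∈ disk := by
  rw [mem_disk, norm_mul, Complex.norm_real, Real.norm_of_nonneg ht.1]
  exact (mul_le_of_le_one_left (norm_nonneg z) ht.2).trans_lt (mem_disk.1 hz)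

theorem continuousOn_comp_ofReal_mul {H : ℂ → ℂ} (hH : ContinuousOn H disk) {z : ℂ}
    (hz : z ∈ disk) : ContinuousOn (fun t : ℝ => H (t * z)) (Icc 0 1) := by
  refine hH.comp (by fun_prop) fun t ht => ofReal_mul_mem_disk ht hz

theorem intervalIntegrable_rpow_mul {κ : ℝ} (hκ : 0 < κ) {g : ℝ → ℂ}
    (hg : ContinuousOn g (Icc 0 1)) :
    IntervalIntegrable (fun t : ℝ => ((t ^ (κ - 1) : ℝ) : ℂ) * g t) volume 0 1 := by
  have h1 : IntervalIntegrable (fun t : ℝ => ((t ^ (κ - 1) : ℝ) : ℂ)) volume 0 1 := by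
    have h := intervalIntegral.intervalIntegrable_rpow' (a := 0) (b := 1)
      (show -1 < κ - 1 by linarith)
    exact ⟨h.1.ofReal, h.2.ofReal⟩
  exact h1.mul_continuousOn (by rwa [uIcc_of_le zero_le_one])

/-- The Bernardi-type integral transform of an analytic function is analytic. -/
theorem hasDerivAt_integral_rpow_mul {κ : ℝ} (hκ : 0 < κ) {H : ℂ → ℂ}
    (hH : DifferentiableOn ℂ H disk) {z : ℂ} (hz : z ∈ disk) :
    HasDerivAt (fun z => ∫ t in (0 : ℝ)..1, ((t ^ (κ - 1) : ℝ) : ℂ) * H (t * z))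
      (∫ t in (0 : ℝ)..1, ((t ^ (κ - 1) : ℝ) : ℂ) * (deriv H (t * z) * t)) z := by
  have hH' : ContinuousOn (deriv H) disk := (hH.deriv isOpen_disk).continuousOn
  obtain ⟨R, hR1, hR2⟩ := exists_between (mem_disk.1 hz)
  have hsub : Metric.closedBall (0 : ℂ) R ⊆ disk := fun x hx =>
    mem_disk.2 ((mem_closedBall_zero_iff.1 hx).trans_lt hR2)
  obtain ⟨M, hM⟩ := (isCompact_closedBall (0 : ℂ) R).exists_bound_of_continuousOn (hH'.mono hsub)
  refine (intervalIntegral.hasDerivAt_integral_of_dominated_loc_of_deriv_le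
    (s := Metric.ball 0 R) (bound := fun t => t ^ (κ - 1) * M)
    (F' := fun x t => ((t ^ (κ - 1) : ℝ) : ℂ) * (deriv H (t * x) * t))
    (Metric.isOpen_ball.mem_nhds (by simpa using hR1)) ?_ ?_ ?_ ?_ ?_ ?_).2
  · filter_upwards [isOpen_disk.mem_nhds hz] with x hx
    exact (intervalIntegrable_rpow_mul hκ
      (continuousOn_comp_ofReal_mul hH.continuousOn hx)).aestronglyMeasurable_restrict_uIoc
  · exact intervalIntegrable_rpow_mul hκ (continuousOn_comp_ofReal_mul hH.continuousOn hz)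
  · exact (intervalIntegrable_rpow_mul hκ ((continuousOn_comp_ofReal_mul hH' hz).mul
      Complex.continuous_ofReal.continuousOn)).aestronglyMeasurable_restrict_uIoc
  · refine Eventually.of_forall fun t ht x hx => ?_
    rw [uIoc_of_le zero_le_one] at ht
    have hx' : ‖x‖ < R := by simpa using hx
    have h1 : ‖deriv H (t * x)‖ ≤ M := by
      refine hM _ ?_
      rw [mem_closedBall_zero_iff, norm_mul, Complex.norm_real, Real.norm_of_nonneg ht.1.le]
      exact (mul_le_of_le_one_left (norm_nonneg x) ht.2).trans hx'.le
    have h2 : 0 ≤ t ^ (κ - 1) := Real.rpow_nonneg ht.1.le _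
    rw [norm_mul, Complex.norm_real, Real.norm_of_nonneg h2, norm_mul, Complex.norm_real,
      Real.norm_of_nonneg ht.1.le]
    gcongr
    exact (mul_le_of_le_one_right (norm_nonneg _) ht.2).trans h1
  · exact (intervalIntegral.intervalIntegrable_rpow' (by linarith)).mul_const M
  · refine Eventually.of_forall fun t ht x hx => ?_
    rw [uIoc_of_le zero_le_one] at ht
    have hxd : x ∈ disk := hsub (Metric.ball_subset_closedBall hx)
    have h1 := hasDerivAt_of_disk hH (ofReal_mul_mem_disk (Ioc_subset_Icc_self ht) hxd)
    have h2 : HasDerivAt (fun x : ℂ => (t : ℂ) * x) t x := by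
      simpa using (hasDerivAt_id x).const_mul (t : ℂ)
    exact (h1.comp x h2).const_mul _

/-- The differential equation of the Bernardi-type integral transform. -/
theorem integral_rpow_mul_ode {κ : ℝ} (hκ : 0 < κ) {H : ℂ → ℂ}
    (hH : DifferentiableOn ℂ H disk) {z : ℂ} (hz : z ∈ disk) :
    z * deriv (fun z => ∫ t in (0 : ℝ)..1, ((t ^ (κ - 1) : ℝ) : ℂ) * H (t * z)) z +
      κ * ∫ t in (0 : ℝ)..1, ((t ^ (κ - 1) : ℝ) : ℂ) * H (t * z) = H z := by
  have hH' : ContinuousOn (deriv H) disk := (hH.deriv isOpen_disk).continuousOn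
  have i1 := intervalIntegrable_rpow_mul hκ (continuousOn_comp_ofReal_mul hH.continuousOn hz)
  have i2 : IntervalIntegrable
      (fun t : ℝ => ((t ^ (κ - 1) : ℝ) : ℂ) * (deriv H (t * z) * t)) volume 0 1 :=
    intervalIntegrable_rpow_mul hκ ((continuousOn_comp_ofReal_mul hH' hz).mul
      Complex.continuous_ofReal.continuousOn)
  rw [(hasDerivAt_integral_rpow_mul hκ hH hz).deriv, ← intervalIntegral.integral_const_mul,
    ← intervalIntegral.integral_const_mul,
    ← intervalIntegral.integral_add (i2.const_mul z) (i1.const_mul (κ : ℂ))]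
  -- The combined integrand is the t-derivative of t^κ H(tz), which vanishes at t = 0.
  have hFTC := intervalIntegral.integral_eq_sub_of_hasDerivAt_of_le zero_le_one
    (f := fun t : ℝ => ((t ^ κ : ℝ) : ℂ) * H (t * z))
    (f' := fun t : ℝ => z * (((t ^ (κ - 1) : ℝ) : ℂ) * (deriv H (t * z) * t)) +
      κ * (((t ^ (κ - 1) : ℝ) : ℂ) * H (t * z))) ?_ ?_ ((i2.const_mul z).add (i1.const_mul (κ : ℂ)))
  · rw [hFTC]
    simp [Real.zero_rpow hκ.ne']
  · refine ContinuousOn.mul ?_ (continuousOn_comp_ofReal_mul hH.continuousOn hz)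
    exact (Complex.continuous_ofReal.comp (Real.continuous_rpow_const hκ.le)).continuousOn
  · intro t ht
    have h1 := (Real.hasDerivAt_rpow_const (p := κ) (Or.inl ht.1.ne')).ofReal_comp
    have h2 : HasDerivAt (fun t : ℝ => (t : ℂ) * z) (1 * z) t :=
      (Complex.ofRealCLM.hasDerivAt (x := t)).mul_const z
    have h3 := (hasDerivAt_of_disk hH (ofReal_mul_mem_disk (Ioo_subset_Icc_self ht) hz)).comp t h2
    refine (h1.mul h3).congr_deriv ?_
    have h4 : t ^ κ = t ^ (κ - 1) * t := by
      rw [Real.rpow_sub_one ht.1.ne', div_mul_cancel₀ _ ht.1.ne']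
    simp only [Function.comp, h4]
    push_cast
    ring

/-- Integral representation of the solution of the Briot–Bouquet equation. -/
theorem isBriotBouquetRecip_integral {κ a b : ℝ} (hκ : 0 < κ) (ha : |a| ≤ 1) (hb : |b| ≤ 1)
    (hab : a ≠ b) {H : ℂ → ℂ} (hH : DifferentiableOn ℂ H disk) (hH0 : ∀ z ∈ disk, H z ≠ 0)
    (hHode : ∀ z ∈ disk, z * deriv H z = κ * (janowski a b z - 1) * H z) :
    IsBriotBouquetRecip κ a b
      (fun z => κ * ((∫ t in (0 : ℝ)..1, ((t ^ (κ - 1) : ℝ) : ℂ) * H (t * z)) / H z)) := by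
  have hJ : DifferentiableOn ℂ
      (fun z => ∫ t in (0 : ℝ)..1, ((t ^ (κ - 1) : ℝ) : ℂ) * H (t * z)) disk := fun z hz =>
    (hasDerivAt_integral_rpow_mul hκ hH hz).differentiableAt.differentiableWithinAt
  refine ⟨hκ, ha, hb, hab, (hJ.div hH hH0).const_mul _, fun z hz => ?_⟩
  have h1 := integral_rpow_mul_ode hκ hH hz
  rw [(((hasDerivAt_of_disk hJ hz).fun_div (hasDerivAt_of_disk hH hz) (hH0 z hz)).const_mul
    (κ : ℂ)).deriv]
  have h2 := hHode z hz
  have h3 := hH0 z hz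
  generalize deriv (fun z => ∫ t in (0 : ℝ)..1, ((t ^ (κ - 1) : ℝ) : ℂ) * H (t * z)) z = J1 at *
  generalize (∫ t in (0 : ℝ)..1, ((t ^ (κ - 1) : ℝ) : ℂ) * H (t * z)) = J0 at *
  field_simp
  linear_combination κ * H z * h1 - κ * J0 * h2

/-- Both arguments lie in (-π/2, π/2), so their difference stays in (-π, π) and no branch jump
occurs. This lets the power in Q split as H(tz)/H(z). -/
theorem div_cpow_of_re_pos {x y : ℂ} (hx : 0 < x.re) (hy : 0 < y.re) (e : ℂ) :
    (x / y) ^ e = Complex.exp (Complex.log x * e) / Complex.exp (Complex.log y * e) := by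
  have hx0 : x ≠ 0 := fun h => by simp [h] at hx
  have hy0 : y ≠ 0 := fun h => by simp [h] at hy
  have hax := Complex.abs_arg_lt_pi_div_two_iff.2 (Or.inl hx)
  have hay := Complex.abs_arg_lt_pi_div_two_iff.2 (Or.inl hy)
  have hyπ : y.arg ≠ Real.pi := fun h => by
    rw [h, abs_of_pos Real.pi_pos] at hay
    linarith [Real.pi_pos]
  rw [Complex.cpow_def_of_ne_zero (div_ne_zero hx0 hy0), div_eq_mul_inv,
    Complex.log_mul hx0 (inv_ne_zero hy0), Complex.log_inv _ hyπ, ← Complex.exp_sub]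
  · ring_nf
  · rw [Complex.arg_inv, if_neg hyπ]
    rw [abs_lt] at hax hay
    constructor <;> linarith

/-- The reciprocal of `q` solves the linear equation associated with the Briot–Bouquet equation. -/
theorem isBriotBouquetRecip_Q (p : ℕ) {α β μ γ A B : ℝ}
    (hβ : 0 < β) (hαβ : 0 < α + p * β) (hμ₀ : 0 < μ) (hμ₁ : μ < 1) (hγ₀ : 0 < γ)
    (hB : -1 ≤ B) (hBA : B < A) (hA : A ≤ 1 - μ * (1 - B)) :
    IsBriotBouquetRecip ((1 - μ) * (α + p * β) / (μ * β * γ)) ((A - μ * B) / (1 - μ)) B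
      (fun z => ((1 - μ) * (α + p * β) / (μ * β * γ) : ℝ) * Q p α β μ γ A B z) := by
  have h1μ : 0 < 1 - μ := by linarith
  set c := (α + p * β) / (μ * β * γ) with hc
  set κ := (1 - μ) * (α + p * β) / (μ * β * γ) with hκ
  have hκc : κ = (1 - μ) * c := by rw [hκ, hc, mul_div_assoc]
  have hκ0 : 0 < κ := by positivity
  set a := (A - μ * B) / (1 - μ) with ha
  have haB : B < a := by rw [ha, lt_div_iff₀ h1μ]; linarith
  have ha1 : a ≤ 1 := by rw [ha, div_le_one h1μ]; linarith
  have hamul : (1 - μ) * a = A - μ * B := by rw [ha]; field_simp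
  have habs : |a| ≤ 1 := abs_le.2 ⟨by linarith, ha1⟩
  have hBabs : |B| ≤ 1 := abs_le.2 ⟨hB, by linarith⟩
  -- Since h - 1 = (a-B)z/(1+Bz), this constant turns z H' = κ(h-1)H into H'/H = c(A-B)/(1+Bz),
  -- solved by exp(cAz) if B = 0 and by (1+Bz)^e otherwise.
  have hκa : κ * (a - B) = c * (A - B) := by
    rw [hκc]; linear_combination c * hamul
  have hκa' : (κ : ℂ) * (a - B) = c * (A - B) := by exact_mod_cast hκa
  rcases eq_or_ne B 0 with hB0 | hB0
  · have hbase := isBriotBouquetRecip_integral hκ0 habs hBabs haB.ne'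
      (H := fun z => Complex.exp (((c * A : ℝ) : ℂ) * z)) (by fun_prop)
      (fun _ _ => Complex.exp_ne_zero _) (fun z hz => by
        have : HasDerivAt (fun z : ℂ => Complex.exp (((c * A : ℝ) : ℂ) * z))
            (Complex.exp (((c * A : ℝ) : ℂ) * z) * (((c * A : ℝ) : ℂ) * 1)) z :=
          ((hasDerivAt_id z).const_mul _).cexp
        rw [this.deriv]
        subst hB0
        simp only [janowski, Complex.ofReal_zero, zero_mul, add_zero, div_one]
        push_cast
        linear_combination (-z * Complex.exp ((c * A : ℂ) * z)) * (by simpa using hκa' :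
          (κ : ℂ) * a = c * A))
    convert hbase using 3 with z
    rw [Q, if_pos hB0, ← intervalIntegral.integral_div]
    refine intervalIntegral.integral_congr fun t _ => ?_
    rw [mul_div_assoc ((t ^ (κ - 1) : ℝ) : ℂ), ← Complex.exp_sub]
    congr 2
    rw [hc]
    push_cast
    ring
  · have hre : ∀ z ∈ disk, 0 < (1 + (B : ℂ) * z).re := fun z hz => re_one_add_mul_pos hBabs hz
    set e : ℝ := c * ((A - B) / B) with he
    have heB : (e : ℂ) * B = c * (A - B) := by
      rw [he]; push_cast
      have : (B : ℂ) ≠ 0 := by exact_mod_cast hB0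
      field_simp
    have hder : ∀ z ∈ disk, HasDerivAt (fun z : ℂ => Complex.exp (Complex.log (1 + B * z) * e))
        (Complex.exp (Complex.log (1 + B * z) * e) * ((B * 1) / (1 + B * z) * e)) z := by
      intro z hz
      exact (((((hasDerivAt_id z).const_mul (B : ℂ)).const_add 1).clog
        (Or.inl (hre z hz))).mul_const (e : ℂ)).cexp
    have hbase := isBriotBouquetRecip_integral hκ0 habs hBabs haB.ne'
      (H := fun z => Complex.exp (Complex.log (1 + B * z) * e))
      (fun z hz => (hder z hz).differentiableAt.differentiableWithinAt)
      (fun _ _ => Complex.exp_ne_zero _) (fun z hz => by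
        rw [(hder z hz).deriv, janowski]
        have hne := one_add_mul_ne_zero hBabs hz
        have hne' : 1 + z * (B : ℂ) ≠ 0 := by rwa [mul_comm z]
        field_simp
        linear_combination z * heB - z * hκa')
    have hQ : ∀ z ∈ disk, Q p α β μ γ A B z = (∫ t in (0 : ℝ)..1, ((t ^ (κ - 1) : ℝ) : ℂ) *
        Complex.exp (Complex.log (1 + B * (t * z)) * e)) /
          Complex.exp (Complex.log (1 + B * z) * e) := by
      intro z hz
      rw [Q, if_neg hB0, ← intervalIntegral.integral_div]
      refine intervalIntegral.integral_congr fun t ht => ?_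
      rw [uIcc_of_le zero_le_one] at ht
      rw [mul_div_assoc ((t ^ (κ - 1) : ℝ) : ℂ), ← mul_assoc, ← div_cpow_of_re_pos _ (hre z hz)]
      rw [mul_assoc]
      exact hre _ (ofReal_mul_mem_disk ht hz)
    have heq : EqOn (fun z => (κ : ℂ) * Q p α β μ γ A B z) _ disk := fun z hz =>
      congrArg (fun x => (κ : ℂ) * x) (hQ z hz)
    refine ⟨hbase.1, hbase.2, hbase.3, hbase.4, hbase.diff.congr heq, fun z hz => ?_⟩
    have := hbase.ode z hz
    rw [(heq.eventuallyEq_of_mem (isOpen_disk.mem_nhds hz)).deriv_eq]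
    have h2 : (κ : ℂ) * Q p α β μ γ A B z = _ := heq hz
    rw [h2]
    exact this

/-! ### Power series in the disk and the operator Θ. -/

/-- The power series with coefficients `c` converges in the unit disk. -/
def SummableCoeff (c : ℕ → ℂ) : Prop :=
  ∀ r : ℝ, 0 < r → r < 1 → Summable fun n => ‖c n‖ * r ^ n

/-- A polynomial factor is absorbed by the geometric gain (r/ρ)^n in passing from r to a slightly
larger radius ρ < 1. -/
theorem SummableCoeff.of_le {c e : ℕ → ℂ} (hc : SummableCoeff c) {C : ℝ} {k : ℕ}
    (h : ∀ n, ‖e n‖ ≤ C * (n + 1) ^ k * ‖c n‖) : SummableCoeff e := by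
  intro r hr0 hr1
  obtain ⟨ρ, hρ1, hρ2⟩ := exists_between hr1
  have hρ0 : 0 < ρ := hr0.trans hρ1
  set x := r / ρ with hx
  have hx0 : 0 < x := div_pos hr0 hρ0
  have hx1 : x < 1 := (div_lt_one hρ0).2 hρ1
  have hr : r = x * ρ := by rw [hx]; field_simp
  have hlim : Tendsto (fun n : ℕ => ((n + 1 : ℕ) : ℝ) ^ k * x ^ (n + 1)) atTop (𝓝 0) :=
    (tendsto_pow_const_mul_const_pow_of_abs_lt_one k (by rwa [abs_of_pos hx0])).comp
      (tendsto_add_atTop_nat 1)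
  refine Summable.of_norm_bounded_eventually_nat ((hc ρ hρ0 hρ2).mul_left |C|) ?_
  filter_upwards [hlim.eventually (gt_mem_nhds hx0)] with n hn
  have h1 : ((n : ℝ) + 1) ^ k * x ^ n ≤ 1 := by
    rw [pow_succ] at hn
    push_cast at hn
    nlinarith
  have h2 : 0 ≤ ‖c n‖ * ρ ^ n := by positivity
  rw [norm_mul, norm_norm, norm_pow, Real.norm_of_nonneg hr0.le, hr, mul_pow]
  calc ‖e n‖ * (x ^ n * ρ ^ n) ≤ (C * (n + 1) ^ k * ‖c n‖) * (x ^ n * ρ ^ n) := by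
        gcongr
        exact h n
    _ = C * (((n + 1) ^ k * x ^ n) * (‖c n‖ * ρ ^ n)) := by ring
    _ ≤ |C| * (((n + 1) ^ k * x ^ n) * (‖c n‖ * ρ ^ n)) := by
        gcongr
        exact le_abs_self C
    _ ≤ |C| * (1 * (‖c n‖ * ρ ^ n)) := by gcongr
    _ = |C| * (‖c n‖ * ρ ^ n) := by rw [one_mul]

theorem SummableCoeff.nat_add_iff {c : ℕ → ℂ} (p : ℕ) :
    SummableCoeff (fun j => c (j + p)) ↔ SummableCoeff c := by
  refine forall_congr' fun r => forall_congr' fun hr0 => forall_congr' fun _ => ?_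
  rw [← summable_nat_add_iff (f := fun n => ‖c n‖ * r ^ n) p,
    ← summable_mul_right_iff (pow_ne_zero p hr0.ne')]
  simp only [mul_assoc, pow_add]

theorem SummableCoeff.summable {c : ℕ → ℂ} (hc : SummableCoeff c) {z : ℂ} (hz : z ∈ disk) :
    Summable fun n => c n * z ^ n := by
  obtain ⟨R, hR1, hR2⟩ := exists_between (mem_disk.1 hz)
  refine Summable.of_norm_bounded (hc R ((norm_nonneg z).trans_lt hR1) hR2) fun n => ?_
  rw [norm_mul, norm_pow]
  gcongr

theorem SummableCoeff.hasDerivAt {c : ℕ → ℂ} (hc : SummableCoeff c) {z : ℂ} (hz : z ∈ disk) :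
    HasDerivAt (fun z => ∑' n, c n * z ^ n) (∑' n, c n * (n * z ^ (n - 1))) z := by
  obtain ⟨R, hR1, hR2⟩ := exists_between (mem_disk.1 hz)
  have hR0 : 0 < R := (norm_nonneg z).trans_lt hR1
  have hd : SummableCoeff fun n => n * c n := hc.of_le (C := 1) (k := 1) fun n => by
    rw [norm_mul, Complex.norm_natCast]
    gcongr
    simp
  have hu : Summable fun n : ℕ => ‖(n : ℂ) * c n‖ * R ^ n * R⁻¹ := (hd R hR0 hR2).mul_right _
  refine hasDerivAt_tsum_of_isPreconnected (g := fun n z => c n * z ^ n)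
    (g' := fun n z => c n * (n * z ^ (n - 1))) hu
    (t := Metric.ball 0 R) Metric.isOpen_ball (convex_ball (0 : ℂ) R).isPreconnected
    (fun n y _ => (hasDerivAt_pow n y).const_mul _) (fun n y hy => ?_)
    (show z ∈ _ by simpa using hR1) (hc.summable hz) (by simpa using hR1)
  rcases n with _ | n
  · simp
  · have hy' : ‖y‖ ≤ R := by simpa using (mem_ball_zero_iff.1 hy).le
    have e : ‖((n + 1 : ℕ) : ℂ) * c (n + 1)‖ * R ^ (n + 1) * R⁻¹ =
        ‖c (n + 1)‖ * (‖((n + 1 : ℕ) : ℂ)‖ * R ^ n) := by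
      rw [norm_mul, pow_succ]
      field_simp
    rw [e, norm_mul, norm_mul, norm_pow, Nat.add_sub_cancel]
    gcongr

theorem SummableCoeff.differentiableOn {c : ℕ → ℂ} (hc : SummableCoeff c) :
    DifferentiableOn ℂ (fun z => ∑' n, c n * z ^ n) disk := fun _ hz =>
  (hc.hasDerivAt hz).differentiableAt.differentiableWithinAt

theorem SummableCoeff.mul_deriv {c : ℕ → ℂ} (hc : SummableCoeff c) {z : ℂ} (hz : z ∈ disk) :
    z * deriv (fun z => ∑' n, c n * z ^ n) z = ∑' n, (n * c n) * z ^ n := by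
  rw [(hc.hasDerivAt hz).deriv, ← tsum_mul_left]
  refine tsum_congr fun n => ?_
  rcases n with _ | n
  · simp
  · rw [Nat.add_sub_cancel, pow_succ]
    ring

theorem SummableCoeff.taylorCoeff_eq {c : ℕ → ℂ} (hc : SummableCoeff c) (n : ℕ) :
    taylorCoeff (fun z => ∑' n, c n * z ^ n) n = c n := by
  have h1 := (hc.differentiableOn.analyticAt
    (isOpen_disk.mem_nhds zero_mem_disk)).hasFPowerSeriesAt
  have h2 : HasFPowerSeriesAt (fun z => ∑' n, c n * z ^ n)
      (FormalMultilinearSeries.ofScalars ℂ c) 0 := by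
    rw [hasFPowerSeriesAt_iff]
    filter_upwards [isOpen_disk.mem_nhds zero_mem_disk] with z hz
    simpa [FormalMultilinearSeries.coeff_ofScalars, mul_comm] using (hc.summable hz).hasSum
  have h3 := congrArg (fun s => s.coeff n) (h1.eq_formalMultilinearSeries h2)
  simpa [FormalMultilinearSeries.coeff_ofScalars, taylorCoeff] using h3

theorem hasSum_taylorCoeff {f : ℂ → ℂ} (hf : DifferentiableOn ℂ f disk) {z : ℂ} (hz : z ∈ disk) :
    HasSum (fun n => taylorCoeff f n * z ^ n) (f z) := by
  have := Complex.hasSum_taylorSeries_on_ball hf hz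
  have h : (fun n => taylorCoeff f n * z ^ n) =
      fun n => ((n.factorial : ℂ))⁻¹ • (z - 0) ^ n • iteratedDeriv n f 0 := by
    funext n
    simp only [taylorCoeff, sub_zero, smul_eq_mul]
    ring
  rw [h]
  exact this

theorem summableCoeff_taylorCoeff {f : ℂ → ℂ} (hf : DifferentiableOn ℂ f disk) :
    SummableCoeff (taylorCoeff f) := by
  intro r hr0 hr1
  have h := (hasSum_taylorCoeff hf (z := (r : ℂ))
    (mem_disk.2 (by rwa [Complex.norm_real, Real.norm_of_nonneg hr0.le]))).summable.norm
  simpa [abs_of_pos hr0] using h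

/-- The quotient `Θ^m f / z ^ p`, as a power series. -/
noncomputable def thetaQuot (p : ℕ) (α β : ℝ) (m : ℤ) (f : ℂ → ℂ) (z : ℂ) : ℂ :=
  ∑' j : ℕ, (((1 + j * (β / (α + p * β))) ^ m : ℝ) * taylorCoeff f (j + p)) * z ^ j

/-- The base is at least 1, so an exponent of either sign gives at most the power |m|, which is
polynomial in j. -/
theorem summableCoeff_zpow_mul {δ : ℝ} (hδ : 0 < δ) (m : ℤ) {c : ℕ → ℂ} (hc : SummableCoeff c) :
    SummableCoeff fun j => ((1 + j * δ) ^ m : ℝ) * c j := by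
  refine hc.of_le (C := (1 + δ) ^ m.natAbs) (k := m.natAbs) fun j => ?_
  have h1 : (1 : ℝ) ≤ 1 + j * δ := by
    have : 0 ≤ j * δ := by positivity
    linarith
  rw [norm_mul, Complex.norm_real, Real.norm_of_nonneg (by positivity)]
  gcongr
  calc (1 + j * δ) ^ m ≤ (1 + j * δ) ^ (m.natAbs : ℤ) := zpow_le_zpow_right₀ h1 Int.le_natAbs
    _ = (1 + j * δ) ^ m.natAbs := zpow_natCast _ _
    _ ≤ ((1 + δ) * (j + 1)) ^ m.natAbs := by
      gcongr
      nlinarith [Nat.cast_nonneg (α := ℝ) j]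
    _ = _ := mul_pow _ _ _

theorem summableCoeff_thetaQuot {p : ℕ} {α β : ℝ} (hβ : 0 < β) (hαβ : 0 < α + p * β) (m : ℤ)
    {f : ℂ → ℂ} (hf : f ∈ ClassA p) :
    SummableCoeff fun j => ((1 + j * (β / (α + p * β))) ^ m : ℝ) * taylorCoeff f (j + p) :=
  summableCoeff_zpow_mul (div_pos hβ hαβ) m
    ((SummableCoeff.nat_add_iff p).2 (summableCoeff_taylorCoeff hf.1))

theorem differentiableOn_thetaQuot {p : ℕ} {α β : ℝ} (hβ : 0 < β) (hαβ : 0 < α + p * β) (m : ℤ)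
    {f : ℂ → ℂ} (hf : f ∈ ClassA p) :
    DifferentiableOn ℂ (thetaQuot p α β m f) disk :=
  (summableCoeff_thetaQuot hβ hαβ m hf).differentiableOn

theorem thetaQuot_zero {p : ℕ} {α β : ℝ} (m : ℤ) {f : ℂ → ℂ} (hf : f ∈ ClassA p) :
    thetaQuot p α β m f 0 = 1 := by
  rw [thetaQuot, tsum_eq_single 0 fun n hn => by simp [hn]]
  simp [hf.2.2]

theorem Theta_eq {p : ℕ} {α β : ℝ} (hβ : 0 < β) (hαβ : 0 < α + p * β) (m : ℤ)
    {f : ℂ → ℂ} (hf : f ∈ ClassA p)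
    {z : ℂ} (hz : z ∈ disk) :
    Theta p α β m f z = z ^ p * thetaQuot p α β m f z := by
  rw [Theta, thetaQuot, ((summableCoeff_thetaQuot hβ hαβ m hf).summable hz).tsum_eq_zero_add,
    mul_add, ← tsum_mul_left]
  congr 1
  · simp [hf.2.2]
  · refine tsum_congr fun j => ?_
    have e : (α + ((p + 1 + j : ℕ) : ℝ) * β) / (α + p * β) =
        1 + ((j + 1 : ℕ) : ℝ) * (β / (α + p * β)) := by
      push_cast
      field_simp
      ring
    rw [e, show p + 1 + j = j + 1 + p by ring, pow_add z (j + 1) p]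
    ring

/-- The extra factor 1 + jδ on the j-th coefficient is the action of 1 + δ z d/dz. This is what
turns the condition on f into a differential one. -/
theorem thetaQuot_succ {p : ℕ} {α β : ℝ} (hβ : 0 < β) (hαβ : 0 < α + p * β) (m : ℤ)
    {f : ℂ → ℂ} (hf : f ∈ ClassA p)
    {z : ℂ} (hz : z ∈ disk) :
    thetaQuot p α β (m + 1) f z = thetaQuot p α β m f z +
      ((β / (α + p * β) : ℝ) : ℂ) * (z * deriv (thetaQuot p α β m f) z) := by
  have hs := summableCoeff_thetaQuot hβ hαβ m hf
  have h1 := hs.mul_deriv hz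
  have hs' : SummableCoeff fun n : ℕ => (n : ℂ) *
      (((1 + n * (β / (α + p * β))) ^ m : ℝ) * taylorCoeff f (n + p)) :=
    hs.of_le (C := 1) (k := 1) fun n => by
      rw [norm_mul, Complex.norm_natCast]
      gcongr
      simp
  have h2 : thetaQuot p α β m f = fun z => ∑' j : ℕ,
      (((1 + j * (β / (α + p * β))) ^ m : ℝ) * taylorCoeff f (j + p)) * z ^ j := rfl
  rw [h2, h1]
  simp only [thetaQuot]
  rw [← tsum_mul_left, ← (hs.summable hz).tsum_add ((hs'.summable hz).mul_left _)]
  refine tsum_congr fun j => ?_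
  have hδ : 0 < β / (α + p * β) := div_pos hβ hαβ
  rw [zpow_add_one₀ (by positivity)]
  push_cast
  ring

theorem powerQuotient_eq {p : ℕ} {α β : ℝ} (hβ : 0 < β) (hαβ : 0 < α + p * β) (m : ℤ)
    {f : ℂ → ℂ} (hf : f ∈ ClassA p)
    (γ : ℝ) {z : ℂ} (hz : z ∈ disk) :
    powerQuotient p α β γ m f z = thetaQuot p α β m f z ^ ((1 / γ : ℝ) : ℂ) := by
  unfold powerQuotient
  split_ifs with h0
  · rw [h0, thetaQuot_zero m hf, Complex.one_cpow]
  · rw [Theta_eq hβ hαβ m hf hz, mul_div_cancel_left₀ _ (pow_ne_zero p h0)]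

theorem thetaRatio_eq {p : ℕ} {α β : ℝ} (hβ : 0 < β) (hαβ : 0 < α + p * β) (m : ℤ)
    {f : ℂ → ℂ} (hf : f ∈ ClassA p)
    {z : ℂ} (hz : z ∈ disk) :
    thetaRatio p α β m f z = thetaQuot p α β (m + 1) f z / thetaQuot p α β m f z := by
  unfold thetaRatio
  split_ifs with h0
  · rw [h0, thetaQuot_zero m hf, thetaQuot_zero (m + 1) hf, div_one]
  · rw [Theta_eq hβ hαβ m hf hz, Theta_eq hβ hαβ (m + 1) hf hz,
      mul_div_mul_left _ _ (pow_ne_zero p h0)]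

/-- Every analytic function with value `1` at the origin is of the form `Θ^m f / z ^ p`. -/
theorem exists_thetaQuot_eq {p : ℕ} {α β : ℝ} (hβ : 0 < β) (hαβ : 0 < α + p * β) (m : ℤ)
    {F : ℂ → ℂ} (hF : DifferentiableOn ℂ F disk) (hF0 : F 0 = 1) :
    ∃ f ∈ ClassA p, EqOn (thetaQuot p α β m f) F disk := by
  have hδ : 0 < β / (α + p * β) := div_pos hβ hαβ
  -- The exponent -m cancels the weights of Θ^m; the natural subtraction n - p is used only when n ≥
  -- p.
  set c : ℕ → ℂ := fun n => if n < p then 0 else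
    ((1 + ((n - p : ℕ) : ℝ) * (β / (α + p * β))) ^ (-m) : ℝ) * taylorCoeff F (n - p) with hc
  have hcp : ∀ j, c (j + p) =
      ((1 + (j : ℝ) * (β / (α + p * β))) ^ (-m) : ℝ) * taylorCoeff F j := fun j => by
    simp [hc]
  have hsc : SummableCoeff c := by
    rw [← SummableCoeff.nat_add_iff p]
    simp only [hcp]
    exact summableCoeff_zpow_mul hδ (-m) (summableCoeff_taylorCoeff hF)
  refine ⟨fun z => ∑' n, c n * z ^ n, ⟨hsc.differentiableOn, fun k hk => ?_, ?_⟩, fun z hz => ?_⟩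
  · rw [hsc.taylorCoeff_eq]
    simp [hc, hk]
  · rw [hsc.taylorCoeff_eq]
    simp [hc, taylorCoeff, hF0]
  · rw [thetaQuot, ← (hasSum_taylorCoeff hF hz).tsum_eq]
    refine tsum_congr fun j => ?_
    have hne : ((1 + (j : ℝ) * (β / (α + p * β)) : ℝ) : ℂ) ≠ 0 := by
      have : 0 < 1 + (j : ℝ) * (β / (α + p * β)) := by positivity
      exact_mod_cast this.ne'
    rw [hsc.taylorCoeff_eq, hcp, Complex.ofReal_zpow, Complex.ofReal_zpow, ← mul_assoc,
      ← zpow_add₀ hne, add_neg_cancel, zpow_zero, one_mul]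

/-! ### From the class to the Briot–Bouquet equation and back. -/

theorem isPreconnected_disk : IsPreconnected disk := (convex_ball (0 : ℂ) 1).isPreconnected

theorem analyticOnNhd_disk {f : ℂ → ℂ} (hf : DifferentiableOn ℂ f disk) :
    AnalyticOnNhd ℂ f disk := (Complex.analyticOnNhd_iff_differentiableOn isOpen_disk).2 hf

theorem differentiableOn_deriv_disk {f : ℂ → ℂ} (hf : DifferentiableOn ℂ f disk) :
    DifferentiableOn ℂ (deriv f) disk := hf.deriv isOpen_disk

/-- If `z F' / F` (with the convention `x / 0 = 0`) plus a positive power of `F` is continuous in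
the disk, then `F` has no zeros. -/
theorem ne_zero_of_continuousOn {F : ℂ → ℂ} (hF : DifferentiableOn ℂ F disk) (hF0 : F 0 = 1)
    {e μ δ : ℝ} (he : 0 < e) (hμ : μ ≠ 0) (hδ : δ ≠ 0)
    (hL : ContinuousOn (fun z => (1 - (μ : ℂ)) * F z ^ (e : ℂ) +
      μ * ((F z + δ * (z * deriv F z)) / F z)) disk) {z₀ : ℂ} (hz₀ : z₀ ∈ disk) : F z₀ ≠ 0 := by
  intro h0
  have hz₀0 : z₀ ≠ 0 := fun h => by rw [h, hF0] at h0; exact one_ne_zero h0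
  have hFa := analyticOnNhd_disk hF
  have hne : ¬ ∀ᶠ z in 𝓝 z₀, F z = 0 := fun h => by
    have := hFa.eqOn_of_preconnected_of_eventuallyEq (g := fun _ => 0) analyticOnNhd_const
      isPreconnected_disk hz₀ h zero_mem_disk
    rw [hF0] at this
    exact one_ne_zero this
  obtain ⟨n, g, hg, hg0, hFg⟩ := (hFa z₀ hz₀).exists_eventuallyEq_pow_smul_nonzero_iff.2 hne
  have hn : n ≠ 0 := by
    rintro rfl
    have := hFg.self_of_nhds
    simp [h0] at this
    exact hg0 this.symm
  obtain ⟨k, rfl⟩ := Nat.exists_eq_succ_of_ne_zero hn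
  set ρ : ℂ → ℂ := fun z => (F z + δ * (z * deriv F z)) / F z with hρ
  -- The power of F is continuous even at a zero, as e > 0, so continuity of the whole expression
  -- passes to the quotient.
  have hρc : ContinuousAt ρ z₀ := by
    have h1 : ContinuousAt (fun z => F z ^ (e : ℂ)) z₀ := by
      have h2 : ContinuousAt (fun x : ℂ => x ^ (e : ℂ)) (F z₀) :=
        Complex.continuousAt_cpow_const_of_re_pos (by simp [h0]) (by simpa using he)
      exact ContinuousAt.comp (f := F) h2 (hFa z₀ hz₀).continuousAt
    have h3 := (hL.continuousAt (isOpen_disk.mem_nhds hz₀)).sub (h1.const_mul (1 - (μ : ℂ)))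
    have h4 := h3.div_const (μ : ℂ)
    have hμc : (μ : ℂ) ≠ 0 := by exact_mod_cast hμ
    refine h4.congr (Eventually.of_forall fun z => ?_)
    simp only [hρ, Pi.sub_apply]
    field_simp
    ring
  have hgd := hg.differentiableAt
  have hder : ∀ᶠ z in 𝓝[≠] z₀, (z - z₀) * ρ z * g z =
      (z - z₀) * g z + δ * z * ((k + 1) * g z + (z - z₀) * deriv g z) := by
    filter_upwards [hFg.eventually_nhds.filter_mono nhdsWithin_le_nhds,
      hg.eventually_analyticAt.filter_mono nhdsWithin_le_nhds,
      (hg.continuousAt.eventually_ne hg0).filter_mono nhdsWithin_le_nhds,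
      self_mem_nhdsWithin] with z h1 h2 h3 h4
    have h4 : z - z₀ ≠ 0 := sub_ne_zero.2 h4
    have hF' : deriv F z = ((k + 1 : ℕ) : ℂ) * (z - z₀) ^ k * g z +
        (z - z₀) ^ (k + 1) * deriv g z := by
      have h5 : HasDerivAt (fun z : ℂ => (z - z₀) ^ (k + 1))
          (((k + 1 : ℕ) : ℂ) * (z - z₀) ^ k) z := by
        simpa using ((hasDerivAt_id z).sub_const z₀).fun_pow (k + 1)
      have h6 := h5.mul h2.differentiableAt.hasDerivAt
      exact (h6.congr_of_eventuallyEq h1).deriv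
    have hFz : F z = (z - z₀) ^ (k + 1) * g z := h1.self_of_nhds
    simp only [hρ, hF', hFz]
    push_cast
    field_simp
    ring
  have hid : Tendsto (fun z : ℂ => z - z₀) (𝓝 z₀) (𝓝 0) := by
    simpa using (continuous_id.sub continuous_const).tendsto (f := fun z : ℂ => z - z₀) z₀
  have hl1 : Tendsto (fun z => (z - z₀) * ρ z * g z) (𝓝[≠] z₀) (𝓝 (0 * ρ z₀ * g z₀)) :=
    ((hid.mul hρc.tendsto).mul hg.continuousAt.tendsto).mono_left nhdsWithin_le_nhds
  have hl2 : Tendsto (fun z => (z - z₀) * g z + δ * z * ((k + 1) * g z + (z - z₀) * deriv g z))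
      (𝓝[≠] z₀) (𝓝 (0 * g z₀ + δ * z₀ * ((k + 1) * g z₀ + 0 * deriv g z₀))) := by
    refine Tendsto.mono_left ?_ nhdsWithin_le_nhds
    exact (hid.mul hg.continuousAt.tendsto).add ((tendsto_id.const_mul _).mul
      ((hg.continuousAt.tendsto.const_mul _).add (hid.mul hg.deriv.continuousAt.tendsto)))
  -- At a zero of order k+1 the quotient has a simple pole with residue δ z₀ (k+1) ≠ 0, whereas
  -- continuity would make (z - z₀)ρ(z) tend to 0.
  have heq := tendsto_nhds_unique (hl1.congr' hder) hl2
  have hk : ((k : ℂ) + 1) ≠ 0 := Nat.cast_add_one_ne_zero k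
  have hδc : (δ : ℂ) ≠ 0 := by exact_mod_cast hδ
  simp [hz₀0, hk, hδc, hg0] at heq

/-- The principal power of `F` satisfies the expected differential equation as soon as it is
analytic. -/
theorem deriv_cpow_mul {F φ : ℂ → ℂ} (hF : DifferentiableOn ℂ F disk) (hF0 : F 0 = 1) {e : ℝ}
    (hφ : DifferentiableOn ℂ φ disk) (hφF : ∀ z ∈ disk, φ z = F z ^ (e : ℂ)) {z : ℂ}
    (hz : z ∈ disk) : deriv φ z * F z = e * deriv F z * φ z := by
  -- F may cross the cut of the principal power far from 0. The identity is therefore checked near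
  -- 0, where F is close to 1, and extended by the identity theorem.
  refine (analyticOnNhd_disk ((differentiableOn_deriv_disk hφ).mul hF)
    ).eqOn_of_preconnected_of_eventuallyEq (analyticOnNhd_disk
      (((differentiableOn_deriv_disk hF).const_mul (e : ℂ)).mul hφ))
      isPreconnected_disk zero_mem_disk ?_ hz
  have hFc : ContinuousAt F 0 := (hasDerivAt_of_disk hF zero_mem_disk).continuousAt
  have hs : ∀ᶠ x in 𝓝 (0 : ℂ), F x ∈ Complex.slitPlane :=
    hFc.eventually_mem (Complex.isOpen_slitPlane.mem_nhds (by rw [hF0]; simp))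
  filter_upwards [hs, isOpen_disk.mem_nhds zero_mem_disk] with x hx hxd
  have h1 : HasDerivAt φ (e * F x ^ ((e : ℂ) - 1) * deriv F x) x := by
    refine ((hasDerivAt_of_disk hF hxd).cpow_const hx).congr_of_eventuallyEq ?_
    filter_upwards [isOpen_disk.mem_nhds hxd] with y hy using hφF y hy
  have hFx : F x ≠ 0 := Complex.slitPlane_ne_zero hx
  simp only [Pi.mul_apply]
  rw [h1.deriv, hφF x hxd, Complex.cpow_sub _ _ hFx, Complex.cpow_one]
  field_simp

theorem Subordinate.congr {f f' g : ℂ → ℂ} (h : Subordinate f g) (hf : EqOn f' f disk) :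
    Subordinate f' g := by
  obtain ⟨h1, h2, w, h3, h4, h5, h6⟩ := h
  exact ⟨h1.congr hf, h2, w, h3, h4, h5, fun z hz => (hf hz).trans (h6 z hz)⟩

theorem janowski_affine {A B μ : ℝ} (hμ₁ : μ ≠ 1) {z : ℂ} (hz : 1 + (B : ℂ) * z ≠ 0) :
    janowski A B z = μ + (1 - μ) * janowski ((A - μ * B) / (1 - μ)) B z := by
  have h : (1 - (μ : ℂ)) ≠ 0 := sub_ne_zero.2 (by exact_mod_cast hμ₁.symm)
  have hz' : 1 + z * (B : ℂ) ≠ 0 := by rwa [mul_comm z]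
  unfold janowski
  push_cast
  field_simp
  ring

/-- Functions of the class solve the Briot–Bouquet differential subordination. -/
theorem Admissible.briotBouquet {p : ℕ} {m : ℤ} {α β μ γ A B : ℝ}
    (hβ : 0 < β) (hαβ : 0 < α + p * β) (hμ₀ : 0 < μ) (hμ₁ : μ < 1) (hγ₀ : 0 < γ)
    (hB : |B| ≤ 1) {f : ℂ → ℂ} (hf : f ∈ Admissible p m α β μ γ A B) :
    DifferentiableOn ℂ (powerQuotient p α β γ m f) disk ∧ powerQuotient p α β γ m f 0 = 1 ∧
      ∃ w : ℂ → ℂ, DifferentiableOn ℂ w disk ∧ w 0 = 0 ∧ MapsTo w disk disk ∧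
        ∀ z ∈ disk, z * deriv (powerQuotient p α β γ m f) z =
          ((1 - μ) * (α + p * β) / (μ * β * γ) : ℝ) * powerQuotient p α β γ m f z *
            (janowski ((A - μ * B) / (1 - μ)) B (w z) - powerQuotient p α β γ m f z) := by
  obtain ⟨hfA, hLd, -, w, hw, hw0, hwm, hLw⟩ := hf
  set F := thetaQuot p α β m f with hFdef
  set φ := powerQuotient p α β γ m f with hφdef
  set δ := β / (α + p * β) with hδdef
  have hδ : 0 < δ := div_pos hβ hαβ
  have hF : DifferentiableOn ℂ F disk := differentiableOn_thetaQuot hβ hαβ m hfA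
  have hF0 : F 0 = 1 := thetaQuot_zero m hfA
  have hφF : ∀ z ∈ disk, φ z = F z ^ ((1 / γ : ℝ) : ℂ) := fun z hz =>
    powerQuotient_eq hβ hαβ m hfA γ hz
  have hρ : ∀ z ∈ disk, thetaRatio p α β m f z = (F z + δ * (z * deriv F z)) / F z :=
    fun z hz => by rw [thetaRatio_eq hβ hαβ m hfA hz, thetaQuot_succ hβ hαβ m hfA hz]
  have hFne : ∀ z ∈ disk, F z ≠ 0 := fun z hz => by
    refine ne_zero_of_continuousOn hF hF0 (one_div_pos.2 hγ₀) hμ₀.ne' hδ.ne'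
      (hLd.continuousOn.congr fun z hz => ?_) hz
    simp only [hφF z hz, hρ z hz]
  have hμc : (μ : ℂ) ≠ 0 := by exact_mod_cast hμ₀.ne'
  have h1μ : (1 - (μ : ℂ)) ≠ 0 := sub_ne_zero.2 (by exact_mod_cast hμ₁.ne')
  -- Analyticity of the principal power is not automatic: it follows by subtracting the quotient,
  -- analytic now that F has no zeros, from the analytic left-hand side.
  have hφd : DifferentiableOn ℂ φ disk := by
    have h1 : DifferentiableOn ℂ (fun z => (F z + δ * (z * deriv F z)) / F z) disk :=
      (hF.add ((differentiableOn_id.mul (differentiableOn_deriv_disk hF)).const_mul _)).div hF hFne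
    refine ((hLd.sub (h1.const_mul (μ : ℂ))).div_const (1 - (μ : ℂ))).congr fun z hz => ?_
    simp only [Pi.sub_apply, hρ z hz]
    field_simp
    ring
  refine ⟨hφd, by simp [hφdef, powerQuotient], w, hw, hw0, hwm, fun z hz => ?_⟩
  have e1 := hLw z hz
  simp only at e1
  rw [hρ z hz, janowski_affine hμ₁.ne (one_add_mul_ne_zero hB (hwm hz))] at e1
  have e2 := deriv_cpow_mul hF hF0 hφd hφF hz
  have hFz := hFne z hz
  have hγc : (γ : ℂ) ≠ 0 := by exact_mod_cast hγ₀.ne'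
  have hβc : (β : ℂ) ≠ 0 := by exact_mod_cast hβ.ne'
  have hαc : ((α : ℂ) + p * β) ≠ 0 := by exact_mod_cast hαβ.ne'
  generalize janowski ((A - μ * B) / (1 - μ)) B (w z) = h at *
  have e3 : (δ : ℂ) = β / (α + p * β) := by rw [hδdef]; push_cast; rfl
  have e4 : μ * δ * (z * deriv F z) = (1 - μ) * (h - φ z) * F z := by
    field_simp at e1
    linear_combination e1
  have e5 : γ * deriv φ z * F z = deriv F z * φ z := by
    push_cast at e2
    field_simp at e2
    linear_combination e2
  have e6 : μ * δ * γ * (z * deriv φ z) = (1 - μ) * φ z * (h - φ z) := by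
    apply mul_right_cancel₀ hFz
    linear_combination μ * δ * z * e5 + φ z * e4
  have hαc' : ((α : ℂ) + β * p) ≠ 0 := by rwa [mul_comm (β : ℂ)]
  rw [e3] at e6
  push_cast
  field_simp
  field_simp at e6
  linear_combination e6

/-- The extremal function of the class. -/
theorem IsBriotBouquetRecip.exists_admissible {p : ℕ} (m : ℤ) {α β μ γ A B : ℝ}
    (hβ : 0 < β) (hαβ : 0 < α + p * β) (hμ₀ : 0 < μ) (hμ₁ : μ < 1) (hγ₀ : 0 < γ) (hγ₁ : γ ≤ 1)
    {V : ℂ → ℂ}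
    (h : IsBriotBouquetRecip ((1 - μ) * (α + p * β) / (μ * β * γ)) ((A - μ * B) / (1 - μ)) B V) :
    ∃ f ∈ Admissible p m α β μ γ A B,
      EqOn (powerQuotient p α β γ m f) (fun z => (V z)⁻¹) disk := by
  set q : ℂ → ℂ := fun z => (V z)⁻¹ with hq
  have hqre : ∀ z ∈ disk, 0 < (q z).re := fun z hz => by
    rw [hq, Complex.inv_re]
    exact div_pos (h.re_pos hz) (Complex.normSq_pos.2 (h.ne_zero hz))
  have hqd : DifferentiableOn ℂ q disk := h.differentiableOn_inv
  have hq0 : q 0 = 1 := by simp [hq, h.apply_zero]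
  set F : ℂ → ℂ := fun z => q z ^ (γ : ℂ) with hFdef
  have hFder : ∀ z ∈ disk, HasDerivAt F (γ * q z ^ ((γ : ℂ) - 1) * deriv q z) z := fun z hz =>
    (hasDerivAt_of_disk hqd hz).cpow_const (Or.inl (hqre z hz))
  have hF : DifferentiableOn ℂ F disk := fun z hz =>
    (hFder z hz).differentiableAt.differentiableWithinAt
  have hF0 : F 0 = 1 := by simp [hFdef, hq0]
  obtain ⟨f, hfA, hfF⟩ := exists_thetaQuot_eq hβ hαβ m hF hF0
  have hγc : (γ : ℂ) ≠ 0 := by exact_mod_cast hγ₀.ne'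
  have hpq : EqOn (powerQuotient p α β γ m f) q disk := by
    intro z hz
    rw [powerQuotient_eq hβ hαβ m hfA γ hz, hfF hz]
    have harg := Complex.abs_arg_lt_pi_div_two_iff.2 (Or.inl (hqre z hz))
    -- Here γ ≤ 1 matters: it keeps the argument of q^γ within the principal range, so that
    -- (q^γ)^(1/γ) = q.
    have h1 : |(Complex.log (q z) * γ).im| < Real.pi := by
      rw [Complex.im_mul_ofReal, Complex.log_im, abs_mul, abs_of_pos hγ₀]
      nlinarith [Real.pi_pos, abs_nonneg (q z).arg]
    rw [abs_lt] at h1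
    rw [hFdef, ← Complex.cpow_mul _ h1.1 h1.2.le]
    push_cast
    rw [mul_one_div_cancel hγc, Complex.cpow_one]
  have hL : EqOn (fun z => (1 - (μ : ℂ)) * powerQuotient p α β γ m f z +
      (μ : ℂ) * thetaRatio p α β m f z) (janowski A B) disk := by
    intro z hz
    have hqz : q z ≠ 0 := inv_ne_zero (h.ne_zero hz)
    have hFz : F z ≠ 0 := by simp [hFdef, Complex.cpow_eq_zero_iff, hqz]
    have hd : deriv (thetaQuot p α β m f) z = γ * F z / q z * deriv q z := by
      rw [(hfF.eventuallyEq_of_mem (isOpen_disk.mem_nhds hz)).deriv_eq, (hFder z hz).deriv,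
        Complex.cpow_sub _ _ hqz, Complex.cpow_one]
      ring
    have hode : z * deriv q z = _ := h.mul_deriv_inv hz
    simp only
    rw [hpq hz, thetaRatio_eq hβ hαβ m hfA hz, thetaQuot_succ hβ hαβ m hfA hz, hd, hfF hz,
      janowski_affine hμ₁.ne (one_add_mul_ne_zero h.abs_right hz)]
    have hode' : z * deriv q z = _ * q z * (_ - q z) := hode
    generalize janowski ((A - μ * B) / (1 - μ)) B z = J at *
    have hμc : (μ : ℂ) ≠ 0 := by exact_mod_cast hμ₀.ne'
    have hβc : (β : ℂ) ≠ 0 := by exact_mod_cast hβ.ne'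
    have hαc : ((α : ℂ) + p * β) ≠ 0 := by exact_mod_cast hαβ.ne'
    push_cast at hode' ⊢
    field_simp at hode' ⊢
    linear_combination hode'
  have hid : Subordinate (janowski A B) (janowski A B) :=
    ⟨differentiableOn_janowski h.abs_right, differentiableOn_janowski h.abs_right, id,
      differentiableOn_id, rfl, fun _ hz => hz, fun _ _ => rfl⟩
  exact ⟨f, ⟨hfA, hid.congr hL⟩, hpq⟩

/-! ### Pochhammer quotients as moments. -/

/-- The quotient `(b)_n / (c)_n` of Pochhammer symbols. -/
noncomputable def pochhammerRatio (b c : ℝ) (n : ℕ) : ℝ :=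
  (ascPochhammer ℝ n).eval b / (ascPochhammer ℝ n).eval c

theorem pochhammerRatio_zero (b c : ℝ) : pochhammerRatio b c 0 = 1 := by simp [pochhammerRatio]

theorem pochhammerRatio_succ {b c : ℝ} (hc : 0 < c) (n : ℕ) :
    pochhammerRatio b c (n + 1) * (c + n) = pochhammerRatio b c n * (b + n) := by
  have h1 := ascPochhammer_pos n c hc
  have h2 : 0 < c + n := by positivity
  unfold pochhammerRatio
  rw [ascPochhammer_succ_eval, ascPochhammer_succ_eval]
  field_simp

/-- Both sides obey the same recursion, by Γ(x+1) = xΓ(x). The right-hand side is the n-th moment of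
the Beta(b, d) distribution. -/
theorem pochhammerRatio_eq_beta {b d : ℝ} (hb : 0 < b) (hd : 0 < d) (n : ℕ) :
    pochhammerRatio b (b + d) n =
      ProbabilityTheory.beta (b + n) d / ProbabilityTheory.beta b d := by
  have hβ := ProbabilityTheory.beta_pos hb hd
  induction n with
  | zero => simp [pochhammerRatio_zero, hβ.ne']
  | succ n ih =>
    have hbn : 0 < b + n := by positivity
    have hbd : 0 < b + d + n := by positivity
    have h1 := pochhammerRatio_succ (b := b) (c := b + d) (by positivity) n
    have h2 : ProbabilityTheory.beta (b + (n + 1 : ℕ)) d * (b + d + n) =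
        ProbabilityTheory.beta (b + n) d * (b + n) := by
      unfold ProbabilityTheory.beta
      have e1 : b + (n + 1 : ℕ) = b + n + 1 := by push_cast; ring
      have e2 : b + n + 1 + d = (b + d + n) + 1 := by ring
      have e3 : b + n + d = b + d + n := by ring
      rw [e1, e2, e3, Real.Gamma_add_one hbn.ne', Real.Gamma_add_one hbd.ne']
      have := Real.Gamma_pos_of_pos hbd
      field_simp
    apply mul_right_cancel₀ hbd.ne'
    rw [h1, ih, div_mul_eq_mul_div, div_mul_eq_mul_div, h2]

theorem integral_betaPDFReal {b d : ℝ} (hb : 0 < b) (hd : 0 < d) :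
    ∫ x, ProbabilityTheory.betaPDFReal b d x = 1 := by
  have hnn : ∀ x, 0 ≤ ProbabilityTheory.betaPDFReal b d x := fun x => by
    by_cases hx : 0 < x ∧ x < 1
    · exact (ProbabilityTheory.betaPDFReal_pos hx.1 hx.2 hb hd).le
    · simp [ProbabilityTheory.betaPDFReal, hx]
  rw [integral_eq_lintegral_of_nonneg_ae (Eventually.of_forall hnn)
    (ProbabilityTheory.measurable_betaPDFReal b d).aestronglyMeasurable]
  have := ProbabilityTheory.lintegral_betaPDF_eq_one hb hd
  simp only [ProbabilityTheory.betaPDF] at this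
  rw [this, ENNReal.toReal_one]

/-- For `0 < b ≤ c` the numbers `(b)_n / (c)_n` are the moments of a probability measure on
`[0, 1]`. -/
theorem exists_measure_moments {b c : ℝ} (hb : 0 < b) (hbc : b ≤ c) :
    ∃ ν : Measure ℝ, IsProbabilityMeasure ν ∧ (∀ᵐ t ∂ν, t ∈ Icc (0 : ℝ) 1) ∧
      ∀ n : ℕ, ∫ t, t ^ n ∂ν = pochhammerRatio b c n := by
  rcases hbc.eq_or_lt with rfl | hlt
  -- When b = c all quotients equal 1, and the Beta law degenerates to a point mass at 1.
  · refine ⟨Measure.dirac 1, inferInstance, ?_, fun n => ?_⟩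
    · rw [ae_dirac_eq]
      simp
    · have := ascPochhammer_pos n b hb
      simp [pochhammerRatio, this.ne']
  · obtain ⟨d, hd, rfl⟩ : ∃ d, 0 < d ∧ c = b + d := ⟨c - b, by linarith, by ring⟩
    have hm : Measurable (ProbabilityTheory.betaPDF b d) :=
      (ProbabilityTheory.measurable_betaPDFReal b d).ennreal_ofReal
    refine ⟨ProbabilityTheory.betaMeasure b d, ProbabilityTheory.isProbabilityMeasureBeta hb hd,
      ?_, fun n => ?_⟩
    · rw [ProbabilityTheory.betaMeasure, ae_withDensity_iff hm]
      refine Eventually.of_forall fun x hx => ?_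
      by_contra hx'
      rw [mem_Icc, not_and_or, not_le, not_le] at hx'
      exact hx (hx'.elim (fun h => ProbabilityTheory.betaPDF_eq_zero_of_nonpos h.le)
        fun h => ProbabilityTheory.betaPDF_eq_zero_of_one_le h.le)
    · have hβ := ProbabilityTheory.beta_pos hb hd
      have hbn : 0 < b + n := by positivity
      have hβn := ProbabilityTheory.beta_pos hbn hd
      rw [ProbabilityTheory.betaMeasure, integral_withDensity_eq_integral_toReal_smul hm
        (Eventually.of_forall fun x => by simp [ProbabilityTheory.betaPDF]),
        pochhammerRatio_eq_beta hb hd, ← mul_one (_ / _), ← integral_betaPDFReal hbn hd,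
        ← integral_const_mul]
      refine integral_congr_ae (Eventually.of_forall fun x => ?_)
      simp only [ProbabilityTheory.betaPDF, smul_eq_mul]
      by_cases hx : 0 < x ∧ x < 1
      · rw [ENNReal.toReal_ofReal (ProbabilityTheory.betaPDFReal_pos hx.1 hx.2 hb hd).le,
          ProbabilityTheory.betaPDFReal, ProbabilityTheory.betaPDFReal, if_pos hx, if_pos hx,
          show b + n - 1 = (b - 1) + n by ring, Real.rpow_add_natCast hx.1.ne']
        field_simp
      · simp [ProbabilityTheory.betaPDFReal, hx]

/-! ### Integrals of (1 - tu)⁻¹ against a probability measure on [0,1]. -/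

theorem le_re_one_sub_mul {t : ℝ} (ht : t ∈ Icc (0 : ℝ) 1) {u : ℂ} {ε : ℝ} (hε : ε ≤ 1)
    (hu : u.re ≤ 1 - ε) : ε ≤ (1 - (t : ℂ) * u).re := by
  simp only [Complex.sub_re, Complex.one_re, Complex.re_ofReal_mul]
  nlinarith [ht.1, ht.2]

theorem norm_inv_one_sub_mul_le {t : ℝ} (ht : t ∈ Icc (0 : ℝ) 1) {u : ℂ} {ε : ℝ} (hε0 : 0 < ε)
    (hε : ε ≤ 1) (hu : u.re ≤ 1 - ε) : ‖(1 - (t : ℂ) * u)⁻¹‖ ≤ ε⁻¹ := by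
  rw [norm_inv]
  exact inv_anti₀ hε0 ((le_re_one_sub_mul ht hε hu).trans (Complex.re_le_norm _))

theorem one_sub_mul_ne_zero {t : ℝ} (ht : t ∈ Icc (0 : ℝ) 1) {u : ℂ} (hu : u.re < 1) :
    1 - (t : ℂ) * u ≠ 0 := fun h => by
  have h1 := le_re_one_sub_mul ht (ε := min 1 (1 - u.re)) (min_le_left _ _)
    (by linarith [min_le_right 1 (1 - u.re)])
  rw [h] at h1
  have : 0 < min 1 (1 - u.re) := lt_min one_pos (by linarith)
  simp only [Complex.zero_re] at h1
  linarith

theorem measurable_inv_one_sub_mul (u : ℂ) : Measurable fun t : ℝ => (1 - (t : ℂ) * u)⁻¹ := by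
  fun_prop

section Stieltjes

variable {ν : Measure ℝ} [IsProbabilityMeasure ν]

theorem integrable_inv_one_sub_mul (hν : ∀ᵐ t ∂ν, t ∈ Icc (0 : ℝ) 1) {u : ℂ} (hu : u.re < 1) :
    Integrable (fun t : ℝ => (1 - (t : ℂ) * u)⁻¹) ν := by
  refine Integrable.of_bound (measurable_inv_one_sub_mul u).aestronglyMeasurable
    (min 1 (1 - u.re))⁻¹ ?_
  filter_upwards [hν] with t ht
  exact norm_inv_one_sub_mul_le ht (lt_min one_pos (by linarith)) (min_le_left _ _)
    (by linarith [min_le_right 1 (1 - u.re)])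

theorem differentiableOn_integral_inv_one_sub_mul (hν : ∀ᵐ t ∂ν, t ∈ Icc (0 : ℝ) 1) :
    DifferentiableOn ℂ (fun u : ℂ => ∫ t, (1 - (t : ℂ) * u)⁻¹ ∂ν) {u | u.re < 1} := by
  intro u₀ hu₀
  have hu₀ : u₀.re < 1 := hu₀
  obtain ⟨x, hx1, hx2⟩ := exists_between hu₀
  set ε := min 1 (1 - x) with hε
  have hε0 : 0 < ε := lt_min one_pos (by linarith)
  have hs : {u : ℂ | u.re < x} ∈ 𝓝 u₀ :=
    (isOpen_lt Complex.continuous_re continuous_const).mem_nhds hx1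
  refine (hasDerivAt_integral_of_dominated_loc_of_deriv_le (s := {u : ℂ | u.re < x})
    (F' := fun u t => -(-(t * 1)) / (1 - (t : ℂ) * u) ^ 2) (bound := fun _ => ε⁻¹ ^ 2) hs
    (Eventually.of_forall fun u => (measurable_inv_one_sub_mul u).aestronglyMeasurable)
    (integrable_inv_one_sub_mul hν hu₀) ?_ ?_ (integrable_const _) ?_).2
      |>.differentiableAt.differentiableWithinAt
  · have : Measurable fun t : ℝ => -(-((t : ℂ) * 1)) / (1 - (t : ℂ) * u₀) ^ 2 := by fun_prop
    exact this.aestronglyMeasurable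
  · filter_upwards [hν] with t ht u hu
    have hu : u.re < x := hu
    have h1 := norm_inv_one_sub_mul_le ht hε0 (min_le_left _ _) (u := u)
      (by linarith [min_le_right 1 (1 - x)])
    rw [neg_neg, mul_one, div_eq_mul_inv, norm_mul, ← inv_pow, norm_pow, Complex.norm_real,
      Real.norm_of_nonneg ht.1]
    calc t * ‖(1 - (t : ℂ) * u)⁻¹‖ ^ 2 ≤ 1 * ε⁻¹ ^ 2 := by
          gcongr
          exact ht.2
      _ = _ := one_mul _
  · filter_upwards [hν] with t ht u hu
    have hu : u.re < 1 := lt_trans hu hx2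
    exact (((hasDerivAt_id u).const_mul (t : ℂ)).const_sub 1).fun_inv (one_sub_mul_ne_zero ht hu)

theorem hasSum_integral_inv_one_sub_mul (hν : ∀ᵐ t ∂ν, t ∈ Icc (0 : ℝ) 1) {M : ℕ → ℝ}
    (hM : ∀ n, ∫ t, t ^ n ∂ν = M n) {u : ℂ} (hu : u ∈ disk) :
    HasSum (fun n => (M n : ℂ) * u ^ n) (∫ t, (1 - (t : ℂ) * u)⁻¹ ∂ν) := by
  have hu' := mem_disk.1 hu
  have hb : ∀ n : ℕ, ∀ᵐ t : ℝ ∂ν, ‖((t : ℂ) * u) ^ n‖ ≤ ‖u‖ ^ n := fun n => by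
    filter_upwards [hν] with t ht
    rw [norm_pow, norm_mul, Complex.norm_real, Real.norm_of_nonneg ht.1]
    have ht0 := ht.1
    gcongr
    exact mul_le_of_le_one_left (norm_nonneg u) ht.2
  have hint : ∀ n : ℕ, Integrable (fun t : ℝ => ((t : ℂ) * u) ^ n) ν := fun n => by
    have hm : Measurable fun t : ℝ => ((t : ℂ) * u) ^ n := by fun_prop
    exact Integrable.of_bound hm.aestronglyMeasurable _ (hb n)
  have h := hasSum_integral_of_summable_integral_norm hint (by
    refine Summable.of_nonneg_of_le (fun n => integral_nonneg fun _ => norm_nonneg _) (fun n => ?_)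
      (summable_geometric_of_lt_one (norm_nonneg u) hu')
    calc ∫ t, ‖((t : ℂ) * u) ^ n‖ ∂ν ≤ ∫ _, ‖u‖ ^ n ∂ν :=
          integral_mono_ae (hint n).norm (integrable_const _) (hb n)
      _ = ‖u‖ ^ n := by simp)
  have e1 : (fun n : ℕ => ∫ t, ((t : ℂ) * u) ^ n ∂ν) = fun n => (M n : ℂ) * u ^ n := by
    funext n
    simp only [mul_pow]
    rw [integral_mul_const, ← hM n, ← integral_complex_ofReal]
    simp
  have e2 : ∫ t, ∑' n : ℕ, ((t : ℂ) * u) ^ n ∂ν = ∫ t, (1 - (t : ℂ) * u)⁻¹ ∂ν := by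
    refine integral_congr_ae ?_
    filter_upwards [hν] with t ht
    exact tsum_geometric_of_norm_lt_one (mem_disk.1 (ofReal_mul_mem_disk ht hu))
  rw [e1, e2] at h
  exact h

theorem summableCoeff_moments (hν : ∀ᵐ t ∂ν, t ∈ Icc (0 : ℝ) 1) {M : ℕ → ℝ}
    (hM : ∀ n, ∫ t, t ^ n ∂ν = M n) : SummableCoeff fun n => (M n : ℂ) := by
  intro r hr0 hr1
  have h := (hasSum_integral_inv_one_sub_mul hν hM (u := (r : ℂ))
    (mem_disk.2 (by rwa [Complex.norm_real, Real.norm_of_nonneg hr0.le]))).summable.norm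
  simpa [abs_of_pos hr0] using h

/-- The differential equation of `₂F₁(1, b; κ + 1; u)`. -/
theorem integral_inv_one_sub_mul_ode (hν : ∀ᵐ t ∂ν, t ∈ Icc (0 : ℝ) 1) {b κ : ℝ} (hκ : 0 < κ)
    (hM : ∀ n, ∫ t, t ^ n ∂ν = pochhammerRatio b (κ + 1) n) {u : ℂ} (hu : u.re < 1) :
    u * (1 - u) * deriv (fun u : ℂ => ∫ t, (1 - (t : ℂ) * u)⁻¹ ∂ν) u +
      (κ - b * u) * ∫ t, (1 - (t : ℂ) * u)⁻¹ ∂ν = κ := by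
  set Φ : ℂ → ℂ := fun u => ∫ t, (1 - (t : ℂ) * u)⁻¹ ∂ν with hΦ
  have hopen : IsOpen {u : ℂ | u.re < 1} := isOpen_lt Complex.continuous_re continuous_const
  have hd : DifferentiableOn ℂ Φ {u | u.re < 1} := differentiableOn_integral_inv_one_sub_mul hν
  have hd' : DifferentiableOn ℂ (deriv Φ) {u | u.re < 1} := hd.deriv hopen
  have hG : AnalyticOnNhd ℂ (fun u => u * (1 - u) * deriv Φ u + (κ - b * u) * Φ u)
      {u | u.re < 1} := by
    rw [Complex.analyticOnNhd_iff_differentiableOn hopen]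
    fun_prop
  have hpre : IsPreconnected {u : ℂ | u.re < 1} :=
    (convex_halfSpace_re_lt 1).isPreconnected
  -- The power series is available only for |u| < 1; the identity theorem carries the equation to
  -- the half-plane Re u < 1, which contains every Bz/(1+Bz).
  refine hG.eqOn_of_preconnected_of_eventuallyEq (g := fun _ => (κ : ℂ)) analyticOnNhd_const hpre
    (z₀ := 0) (by simp) ?_ hu
  have hsc := summableCoeff_moments hν hM
  filter_upwards [isOpen_disk.mem_nhds zero_mem_disk] with x hx
  have hΦS : ∀ y ∈ disk, Φ y = ∑' n : ℕ, (pochhammerRatio b (κ + 1) n : ℂ) * y ^ n := fun y hy =>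
    (hasSum_integral_inv_one_sub_mul hν hM hy).tsum_eq.symm
  have hder : x * deriv Φ x = ∑' n : ℕ, (n * (pochhammerRatio b (κ + 1) n : ℂ)) * x ^ n := by
    rw [← hsc.mul_deriv hx]
    congr 1
    refine EventuallyEq.deriv_eq ?_
    filter_upwards [isOpen_disk.mem_nhds hx] with y hy using hΦS y hy
  have hsc' : SummableCoeff fun n => n * (pochhammerRatio b (κ + 1) n : ℂ) :=
    hsc.of_le (C := 1) (k := 1) fun n => by
      rw [norm_mul, Complex.norm_natCast]
      gcongr
      simp
  have s0 := hsc.summable hx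
  have s1 := hsc'.summable hx
  -- The recursion (κ+1+n)M(n+1) = (b+n)M(n) makes this series, apart from its constant term κ,
  -- equal to the one in `k2`.
  have k1 : x * deriv Φ x + κ * Φ x = κ + ∑' n : ℕ, (n + b) *
      (pochhammerRatio b (κ + 1) n : ℂ) * x ^ (n + 1) := by
    rw [hder, hΦS x hx, ← tsum_mul_left, ← s1.tsum_add (s0.mul_left (κ : ℂ)),
      (s1.add (s0.mul_left (κ : ℂ))).tsum_eq_zero_add]
    congr 1
    · simp [pochhammerRatio_zero]
    · refine tsum_congr fun n => ?_
      have h := pochhammerRatio_succ (b := b) (show 0 < κ + 1 by linarith) n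
      have h' : (pochhammerRatio b (κ + 1) (n + 1) : ℂ) * (κ + 1 + n) =
        (pochhammerRatio b (κ + 1) n : ℂ) * (b + n) := by exact_mod_cast h
      push_cast
      linear_combination x ^ (n + 1) * h'
  have k2 : x * (x * deriv Φ x) + b * x * Φ x = ∑' n : ℕ, (n + b) *
      (pochhammerRatio b (κ + 1) n : ℂ) * x ^ (n + 1) := by
    rw [hder, hΦS x hx, ← tsum_mul_left, ← tsum_mul_left,
      ← (s1.mul_left x).tsum_add (s0.mul_left ((b : ℂ) * x))]
    refine tsum_congr fun n => ?_
    ring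
  linear_combination k1 - k2

end Stieltjes

/-! ### The sharp lower bound for Re q. -/

/-- Inversion carries the half-plane Re s ≥ 1/ρ to the disk with diameter [0, ρ], without the
origin. Such disks behave well under averaging, which half-plane bounds on the reciprocal do not
show directly. -/
theorem norm_inv_sub_le_iff {s : ℂ} (hs : s ≠ 0) {ρ : ℝ} (hρ : 0 < ρ) :
    ‖s⁻¹ - ((ρ / 2 : ℝ) : ℂ)‖ ≤ ρ / 2 ↔ ρ⁻¹ ≤ s.re := by
  have e : s⁻¹ - ((ρ / 2 : ℝ) : ℂ) = (2 - ρ * s) / (2 * s) := by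
    push_cast
    field_simp
  have hn : 0 < ‖s‖ := norm_pos_iff.2 hs
  rw [e, norm_div, norm_mul, Complex.norm_ofNat, div_le_iff₀ (by positivity),
    show ρ / 2 * (2 * ‖s‖) = ρ * ‖s‖ by ring, ← sq_le_sq₀ (norm_nonneg _) (by positivity),
    mul_pow, Complex.sq_norm, Complex.sq_norm, Complex.normSq_apply, Complex.normSq_apply,
    inv_le_iff_one_le_mul₀' hρ]
  simp only [Complex.sub_re, Complex.sub_im, Complex.re_ofReal_mul, Complex.im_ofReal_mul,
    Complex.re_ofNat, Complex.im_ofNat]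
  constructor <;> intro h <;> nlinarith

/-- The expression is 1 - 1/(1+Bz), and the bound is its limit as z → -1. -/
theorem re_moebius_le {B : ℝ} (hB : -1 ≤ B) (hB0 : B < 0) {z : ℂ} (hz : z ∈ disk) :
    ((B : ℂ) * z / (1 + B * z)).re ≤ B / (B - 1) := by
  have habs : |B| ≤ 1 := abs_le.2 ⟨hB, by linarith⟩
  have hne := one_add_mul_ne_zero habs hz
  have e : (B : ℂ) * z / (1 + B * z) = 1 - (1 + (B : ℂ) * z)⁻¹ := by
    field_simp
    ring
  have hn := Complex.normSq_pos.2 hne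
  have e2 : B / (B - 1) = 1 - (1 - B)⁻¹ := by
    have : B - 1 ≠ 0 := by linarith
    have : 1 - B ≠ 0 := by linarith
    field_simp
    ring
  rw [e, e2, Complex.sub_re, Complex.one_re, Complex.inv_re]
  refine sub_le_sub_left ?_ 1
  rw [inv_eq_one_div, div_le_div_iff₀ (by linarith) hn]
  have hm : ‖(B : ℂ) * z‖ ≤ -B := by
    rw [norm_mul, Complex.norm_real, Real.norm_eq_abs, abs_of_neg hB0]
    exact mul_le_of_le_one_right (by linarith) (mem_disk.1 hz).le
  have hre := Complex.abs_re_le_norm ((B : ℂ) * z)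
  have hsq : ‖(B : ℂ) * z‖ ^ 2 = ((B : ℂ) * z).re ^ 2 + ((B : ℂ) * z).im ^ 2 := by
    rw [Complex.sq_norm, Complex.normSq_apply]
    ring
  rw [Complex.normSq_apply]
  simp only [Complex.add_re, Complex.one_re, Complex.add_im, Complex.one_im]
  generalize (B : ℂ) * z = x at *
  have h0 := norm_nonneg x
  have h1 : x.re ≤ ‖x‖ := (abs_le.1 hre).2
  nlinarith [mul_nonneg (sub_nonneg.2 hm) (by linarith : 0 ≤ 1 + ‖x‖),
    mul_nonneg (by linarith : 0 ≤ 1 + B) (by linarith : 0 ≤ ‖x‖ - x.re)]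

theorem hypergeometric_one_eq {b c x : ℝ} :
    ordinaryHypergeometric (1 : ℝ) b c x = ∑' n, pochhammerRatio b c n * x ^ n := by
  rw [ordinaryHypergeometric_eq_tsum]
  refine tsum_congr fun n => ?_
  rw [ascPochhammer_eval_one, inv_mul_cancel₀ (by exact_mod_cast n.factorial_ne_zero), one_mul,
    smul_eq_mul, pochhammerRatio, div_eq_mul_inv]
namespace IsBriotBouquetRecip

variable {κ a B : ℝ} {V : ℂ → ℂ}

/-- With u = Bz/(1+Bz) one has u(1-u) = z du/dz and κ - bu = κh, so the hypergeometric equation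
becomes the linear equation of V. Analytic solutions of the latter are unique because Re h > 0. -/
theorem eq_integral (h : IsBriotBouquetRecip κ a B V) (hB0 : B < 0) {b : ℝ}
    (hb : b * B = κ * (B - a)) {ν : Measure ℝ} [IsProbabilityMeasure ν]
    (hν : ∀ᵐ t ∂ν, t ∈ Icc (0 : ℝ) 1)
    (hM : ∀ n, ∫ t, t ^ n ∂ν = pochhammerRatio b (κ + 1) n) {z : ℂ} (hz : z ∈ disk) :
    V z = ∫ t, (1 - ((t : ℝ) : ℂ) * (B * z / (1 + B * z)))⁻¹ ∂ν := by
  set Φ : ℂ → ℂ := fun u => ∫ t, (1 - ((t : ℝ) : ℂ) * u)⁻¹ ∂ν with hΦ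
  have hB : -1 ≤ B := (abs_le.1 h.abs_right).1
  have hopen : IsOpen {u : ℂ | u.re < 1} := isOpen_lt Complex.continuous_re continuous_const
  have hu : ∀ z ∈ disk, ((B : ℂ) * z / (1 + B * z)).re < 1 := fun z hz =>
    (re_moebius_le hB hB0 hz).trans_lt ((div_lt_one_of_neg (by linarith)).2 (by linarith))
  have hder : ∀ z ∈ disk, HasDerivAt (fun z => Φ (B * z / (1 + B * z)))
      (deriv Φ (B * z / (1 + B * z)) * (B / (1 + B * z) ^ 2)) z := fun z hz => by
    have hne := one_add_mul_ne_zero h.abs_right hz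
    have h1 : HasDerivAt (fun z : ℂ => (B : ℂ) * z) B z := by
      simpa using (hasDerivAt_id z).const_mul (B : ℂ)
    have h2 : HasDerivAt (fun z : ℂ => (B : ℂ) * z / (1 + B * z)) (B / (1 + B * z) ^ 2) z :=
      (h1.fun_div (h1.const_add 1) hne).congr_deriv (by congr 1; ring)
    have h3 : HasDerivAt Φ (deriv Φ (B * z / (1 + B * z))) (B * z / (1 + B * z)) :=
      ((differentiableOn_integral_inv_one_sub_mul hν).differentiableAt
        (hopen.mem_nhds (hu z hz))).hasDerivAt
    exact h3.comp z h2
  refine eqOn_of_linear_ode (W := fun z => Φ (B * z / (1 + B * z)))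
    (P := fun z => κ * janowski a B z) (R := fun _ => κ) h.diff
    (fun z hz => (hder z hz).differentiableAt.differentiableWithinAt) (fun z hz => ?_) h.ode
    (fun z hz => ?_) hz
  · rw [Complex.re_ofReal_mul]
    exact mul_pos h.kappa_pos (janowski_re_pos h.abs_left h.abs_right hz)
  · have hode := integral_inv_one_sub_mul_ode hν h.kappa_pos hM (hu z hz)
    rw [(hder z hz).deriv]
    change _ * deriv Φ _ + _ * Φ _ = _ at hode
    generalize deriv Φ (B * z / (1 + B * z)) = Φ1 at *
    generalize Φ (B * z / (1 + B * z)) = Φ0 at *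
    have hne := one_add_mul_ne_zero h.abs_right hz
    have hne' : 1 + z * (B : ℂ) ≠ 0 := by rwa [mul_comm z]
    have hb' : (b : ℂ) * B = κ * (B - a) := by exact_mod_cast hb
    have e1 : (B : ℂ) * z / (1 + B * z) * (1 - B * z / (1 + B * z)) =
        z * (B / (1 + B * z) ^ 2) := by
      field_simp
      ring
    have e2 : (κ : ℂ) - b * (B * z / (1 + B * z)) = κ * janowski a B z := by
      rw [janowski]
      field_simp
      linear_combination -z * hb'
    rw [e1, e2] at hode
    linear_combination hode

/-- Sharp lower bound for the real part of the solution. -/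
theorem hypergeometric_bound (h : IsBriotBouquetRecip κ a B V) (hB0 : B < 0) (haB : B < a) {b : ℝ}
    (hb : b * B = κ * (B - a)) (hbκ : b ≤ κ + 1) :
    (∀ z ∈ disk, (ordinaryHypergeometric (1 : ℝ) b (κ + 1) (B / (B - 1)))⁻¹ < ((V z)⁻¹).re) ∧
      Tendsto (fun r : ℝ => ((V (-r : ℝ))⁻¹).re) (𝓝[<] 1)
        (𝓝 (ordinaryHypergeometric (1 : ℝ) b (κ + 1) (B / (B - 1)))⁻¹) := by
  have hκ := h.kappa_pos
  have hB : -1 ≤ B := (abs_le.1 h.abs_right).1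
  have hb0 : 0 < b := by
    by_contra! hle
    nlinarith [mul_pos hκ (sub_pos.2 haB)]
  obtain ⟨ν, hνp, hν, hM⟩ := exists_measure_moments hb0 hbκ
  set x₀ := B / (B - 1) with hx₀
  have hx₀0 : 0 < x₀ := div_pos_of_neg_of_neg hB0 (by linarith)
  have hx₀1 : x₀ < 1 := (div_lt_one_of_neg (by linarith)).2 (by linarith)
  have hx₀d : (x₀ : ℂ) ∈ disk :=
    mem_disk.2 (by rwa [Complex.norm_real, Real.norm_of_nonneg hx₀0.le])
  set F₀ := ordinaryHypergeometric (1 : ℝ) b (κ + 1) x₀ with hF₀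
  have hsum := hasSum_integral_inv_one_sub_mul hν hM hx₀d
  have hF₀S : (F₀ : ℂ) = ∑' n, (pochhammerRatio b (κ + 1) n : ℂ) * (x₀ : ℂ) ^ n := by
    rw [hF₀, hypergeometric_one_eq, Complex.ofReal_tsum]
    push_cast
    rfl
  have hρint : Integrable (fun t : ℝ => (1 - t * x₀)⁻¹) ν := by
    have := (integrable_inv_one_sub_mul hν (u := (x₀ : ℂ)) (by simpa using hx₀1)).re
    refine this.congr (Eventually.of_forall fun t => ?_)
    have e : (1 - (t : ℂ) * x₀)⁻¹ = (((1 - t * x₀)⁻¹ : ℝ) : ℂ) := by push_cast; rfl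
    change ((1 - (t : ℂ) * x₀)⁻¹).re = _
    rw [e, Complex.ofReal_re]
  have hF₀int : F₀ = ∫ t, (1 - t * x₀)⁻¹ ∂ν := by
    have : (F₀ : ℂ) = ((∫ t, (1 - t * x₀)⁻¹ ∂ν : ℝ) : ℂ) := by
      rw [hF₀S, hsum.tsum_eq, ← integral_complex_ofReal]
      simp
    exact_mod_cast this
  have hF₀1 : 1 ≤ F₀ := by
    rw [hF₀int]
    calc (1 : ℝ) = ∫ _, (1 : ℝ) ∂ν := by simp
      _ ≤ _ := by
        refine integral_mono_ae (integrable_const _) hρint ?_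
        filter_upwards [hν] with t ht
        have h1 : 0 < 1 - t * x₀ := by nlinarith [ht.1, ht.2]
        exact (one_le_inv₀ h1).2 (by nlinarith [ht.1, ht.2])
  have hF₀0 : 0 < F₀ := by linarith
  have hle : ∀ z ∈ disk, F₀⁻¹ ≤ ((V z)⁻¹).re := by
    intro z hz
    have hVne := h.ne_zero hz
    rw [← norm_inv_sub_le_iff (inv_ne_zero hVne) hF₀0, inv_inv]
    have hu := re_moebius_le hB hB0 hz
    have hu1 : ((B : ℂ) * z / (1 + B * z)).re < 1 := hu.trans_lt hx₀1
    have hi := integrable_inv_one_sub_mul hν hu1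
    have hi2 : Integrable (fun t : ℝ => (((1 - t * x₀)⁻¹ / 2 : ℝ) : ℂ)) ν :=
      (hρint.div_const 2).ofReal
    have e : V z - ((F₀ / 2 : ℝ) : ℂ) =
        ∫ t, ((1 - ((t : ℝ) : ℂ) * (B * z / (1 + B * z)))⁻¹ - (((1 - t * x₀)⁻¹ / 2 : ℝ) : ℂ)) ∂ν := by
      rw [integral_sub hi hi2, integral_complex_ofReal, integral_div, ← hF₀int,
        h.eq_integral hB0 hb hν hM hz]
    rw [e, show F₀ / 2 = ∫ t, (1 - t * x₀)⁻¹ / 2 ∂ν by rw [integral_div, ← hF₀int]]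
    -- Centre and radius of the disk for V are the ν-averages of those for the integrand, so the
    -- pointwise estimates integrate.
    refine norm_integral_le_of_norm_le (hρint.div_const 2) ?_
    filter_upwards [hν] with t ht
    have h1 : 0 < 1 - t * x₀ := by nlinarith [ht.1, ht.2]
    rw [norm_inv_sub_le_iff (one_sub_mul_ne_zero ht hu1) (inv_pos.2 h1), inv_inv]
    simp only [Complex.sub_re, Complex.one_re, Complex.re_ofReal_mul]
    nlinarith [mul_le_mul_of_nonneg_left hu ht.1]
  refine ⟨fun z hz => (hle z hz).lt_of_ne fun heq => ?_, ?_⟩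
  -- Strictness: the image of q is open, so equality would let a point slightly to the left violate
  -- the bound.
  · have hopen := (hasDerivAt_invFunOn isOpen_disk h.differentiableOn_inv h.injOn_inv
      (fun z hz => h.deriv_inv_ne_zero hz)).1
    have hlim : Tendsto (fun ε : ℝ => (V z)⁻¹ - (ε : ℂ)) (𝓝[>] 0) (𝓝 ((V z)⁻¹)) := by
      have : Continuous fun ε : ℝ => (V z)⁻¹ - (ε : ℂ) := by fun_prop
      simpa using (this.tendsto 0).mono_left nhdsWithin_le_nhds
    obtain ⟨ε, ⟨y, hy, hy'⟩, hε⟩ := ((hlim.eventually_mem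
      (hopen.mem_nhds (mem_image_of_mem _ hz))).and self_mem_nhdsWithin).exists
    have h1 := hle y hy
    simp only at hy'
    rw [hy', Complex.sub_re, ← heq, Complex.ofReal_re] at h1
    have hε : 0 < ε := hε
    linarith
  -- Along z = -r the variable u tends to x₀, which is inside the unit disk even for B = -1, so the
  -- series is continuous there.
  · have hsc := summableCoeff_moments hν hM
    have hcont : ContinuousAt (fun u : ℂ => ∑' n, (pochhammerRatio b (κ + 1) n : ℂ) * u ^ n)
        (x₀ : ℂ) := (hsc.hasDerivAt hx₀d).continuousAt
    have hu : Tendsto (fun r : ℝ => (B : ℂ) * ((-r : ℝ) : ℂ) / (1 + B * ((-r : ℝ) : ℂ))) (𝓝[<] 1)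
        (𝓝 (x₀ : ℂ)) := by
      have hx : (x₀ : ℂ) = (B : ℂ) * ((-1 : ℝ) : ℂ) / (1 + B * ((-1 : ℝ) : ℂ)) := by
        rw [hx₀]
        push_cast
        rw [← neg_div_neg_eq]
        congr 1 <;> ring
      have hc : ContinuousAt (fun r : ℝ => (B : ℂ) * ((-r : ℝ) : ℂ) / (1 + B * ((-r : ℝ) : ℂ))) 1 := by
        refine ContinuousAt.div (by fun_prop) (by fun_prop) ?_
        have : (1 - B : ℝ) ≠ 0 := by linarith
        have : ((1 - B : ℝ) : ℂ) ≠ 0 := by exact_mod_cast this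
        push_cast at this ⊢
        rwa [mul_neg, mul_one, ← sub_eq_add_neg]
      rw [hx]
      exact hc.tendsto.mono_left nhdsWithin_le_nhds
    have hV : Tendsto (fun r : ℝ => V (-r : ℝ)) (𝓝[<] 1) (𝓝 (F₀ : ℂ)) := by
      rw [hF₀S]
      refine (hcont.tendsto.comp hu).congr' ?_
      filter_upwards [hu.eventually_mem (isOpen_disk.mem_nhds hx₀d),
        Ioo_mem_nhdsLT (show (0 : ℝ) < 1 by norm_num)] with r hr hr'
      have hrd : ((-r : ℝ) : ℂ) ∈ disk := by
        rw [mem_disk, Complex.norm_real, norm_neg, Real.norm_of_nonneg hr'.1.le]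
        exact hr'.2
      rw [h.eq_integral hB0 hb hν hM hrd]
      exact (hasSum_integral_inv_one_sub_mul hν hM hr).tsum_eq
    have h1 := (Complex.continuous_re.tendsto _).comp
      (hV.inv₀ (show (F₀ : ℂ) ≠ 0 by exact_mod_cast hF₀0.ne'))
    rw [← Complex.ofReal_inv, Complex.ofReal_re] at h1
    exact h1

end IsBriotBouquetRecip

end DiskSubordination

/-! ### The main theorem. -/

open DiskSubordination in
theorem mainTheorem3 (p : ℕ) (hp : 1 ≤ p) (m : ℤ) (α β μ γ A B : ℝ)
    (hβ : 0 < β) (hαβ : 0 < α + p * β)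
    (hμ₀ : 0 < μ) (hμ₁ : μ < 1) (hγ₀ : 0 < γ) (hγ₁ : γ ≤ 1)
    (hB : -1 ≤ B) (hBA : B < A) (hA₁ : A ≤ 1) (hA : A ≤ 1 - μ * (1 - B)) :
    (∀ f ∈ DiskSubordination.Admissible p m α β μ γ A B,
      DiskSubordination.Subordinate (DiskSubordination.powerQuotient p α β γ m f)
        (DiskSubordination.q p α β μ γ A B)) ∧
    DiskSubordination.Subordinate (DiskSubordination.q p α β μ γ A B)
      (DiskSubordination.janowski ((A - μ * B) / (1 - μ)) B) ∧
    DiskSubordination.IsBestDominant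
      (DiskSubordination.powerQuotient p α β γ m ''
        DiskSubordination.Admissible p m α β μ γ A B)
      (DiskSubordination.q p α β μ γ A B) ∧
    (B < 0 → A ≤ min (1 - μ * (1 - B)) (-μ * (β * γ / (α + p * β) - 1) * B) →
      (∀ f ∈ DiskSubordination.Admissible p m α β μ γ A B, ∀ z ∈ DiskSubordination.disk,
        DiskSubordination.xi p α β μ γ A B <
          (DiskSubordination.powerQuotient p α β γ m f z).re) ∧
      (∀ ξ' : ℝ,
        (∀ f ∈ DiskSubordination.Admissible p m α β μ γ A B, ∀ z ∈ DiskSubordination.disk,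
          ξ' < (DiskSubordination.powerQuotient p α β γ m f z).re) →
        ξ' ≤ DiskSubordination.xi p α β μ γ A B)) := by
  have hV := isBriotBouquetRecip_Q p hβ hαβ hμ₀ hμ₁ hγ₀ hB hBA hA
  set V : ℂ → ℂ := fun z => ((1 - μ) * (α + p * β) / (μ * β * γ) : ℝ) * Q p α β μ γ A B z with hVdef
  have hq : q p α β μ γ A B = fun z => (V z)⁻¹ := by
    funext z
    simp only [q, hVdef]
    rw [mul_inv, ← Complex.ofReal_inv, inv_div, one_div]
  have hBabs := hV.abs_right
  have hsub : ∀ f ∈ Admissible p m α β μ γ A B,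
      Subordinate (powerQuotient p α β γ m f) (q p α β μ γ A B) := by
    intro f hf
    obtain ⟨h1, h2, w, h3, h4, h5, h6⟩ := Admissible.briotBouquet hβ hαβ hμ₀ hμ₁ hγ₀ hBabs hf
    rw [hq]
    exact hV.subordinate_inv h1 h2 h3 h4 h5 h6
  obtain ⟨f₀, hf₀, hf₀q⟩ := hV.exists_admissible m hβ hαβ hμ₀ hμ₁ hγ₀ hγ₁
  refine ⟨hsub, hq ▸ hV.subordinate_janowski, ⟨⟨?_, ?_, ?_⟩, fun g hg => ?_⟩, fun hB0 hA' => ?_⟩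
  · exact hq ▸ hV.differentiableOn_inv
  · exact hq ▸ hV.injOn_inv
  · rintro _ ⟨f, hf, rfl⟩
    exact hsub f hf
  · rw [hq]
    -- On the disk q coincides with the member of the family given by f₀, so any dominant dominates
    -- q.
    exact (hg.2.2 _ (mem_image_of_mem _ hf₀)).congr hf₀q.symm
  · have h1μ : 0 < 1 - μ := by linarith
    have haB : B < (A - μ * B) / (1 - μ) := by rw [lt_div_iff₀ h1μ]; linarith
    set c := (α + p * β) / (μ * β * γ) with hc
    have hc0 : 0 < c := by positivity
    have hκc : (1 - μ) * (α + p * β) / (μ * β * γ) = (1 - μ) * c := by rw [hc, mul_div_assoc]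
    have hb : c * ((B - A) / B) * B =
        (1 - μ) * (α + p * β) / (μ * β * γ) * (B - (A - μ * B) / (1 - μ)) := by
      have hBne := hB0.ne
      rw [hκc]
      field_simp
      ring
    -- The second bound on A, multiplied by c and rearranged with B < 0, is precisely b ≤ κ+1, the
    -- condition for the moment representation.
    have hbκ : c * ((B - A) / B) ≤ (1 - μ) * (α + p * β) / (μ * β * γ) + 1 := by
      have h1 : A ≤ -μ * (β * γ / (α + p * β) - 1) * B := hA'.trans (min_le_right _ _)
      have h2 : μ * (β * γ / (α + p * β)) * c = 1 := by
        have hne : α + β * p ≠ 0 := by rw [mul_comm β]; exact hαβ.ne'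
        rw [hc]
        field_simp
      have h3 : c * A ≤ c * (-μ * (β * γ / (α + p * β) - 1) * B) := by gcongr
      have h4 : c * (-μ * (β * γ / (α + p * β) - 1) * B) = -B + c * μ * B := by
        linear_combination -B * h2
      rw [hκc, ← mul_div_assoc, div_le_iff_of_neg hB0]
      linarith
    obtain ⟨hlt, hlim⟩ := hV.hypergeometric_bound hB0 haB hb hbκ
    have hxi : xi p α β μ γ A B = (ordinaryHypergeometric (1 : ℝ) (c * ((B - A) / B))
      ((1 - μ) * (α + p * β) / (μ * β * γ) + 1) (B / (B - 1)))⁻¹ := rfl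
    rw [← hxi] at hlt hlim
    refine ⟨fun f hf z hz => ?_, fun ξ' hξ' => ?_⟩
    · obtain ⟨-, -, w, -, -, hwm, hw⟩ := hsub f hf
      rw [hw z hz, hq]
      exact hlt _ (hwm hz)
    · refine ge_of_tendsto hlim ?_
      filter_upwards [Ioo_mem_nhdsLT (show (0 : ℝ) < 1 by norm_num)] with r hr
      have hrd : ((-r : ℝ) : ℂ) ∈ disk := by
        rw [mem_disk, Complex.norm_real, norm_neg, Real.norm_of_nonneg hr.1.le]
        exact hr.2
      have := hξ' f₀ hf₀ _ hrd
      rw [hf₀q hrd] at this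
      exact this.le
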